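/- For $n\ge 1$ let $\mathbb X_n=\{z\in\mathbb C^{n+1} : \sum_i z_i^2=-1\}$ with the field of bilinear forms induced by $\langle v,w\rangle=\sum_i v_iw_i$ on $\mathbb C^{n+1}$. Let $SL(2,\mathbb C)$ and $PSL(2,\mathbb C)$ carry $\tfrac18$ of their global Killing forms (the Killing form of $\mathfrak{sl}_2$ at the identity, extended by left translations), let $SL(2,\mathbb C)\cap\mathfrak{sl}_2=\{M:\det M=1,\ \operatorname{tr}M=0\}$ carry the form induced by $SL(2,\mathbb C)$, and let its image $Q\subset PSL(2,\mathbb C)$ carry the form induced by $PSL(2,\mathbb C)$. Let $\mathcal G=(\partial\mathbb H^3\times\partial\mathbb H^3)\setminus\Delta$, with $\partial\mathbb H^3=\mathbb C\cup\{\infty\}$, be the complex surface of oriented geodesics of $\mathbb H^3$, with $\langle\cdot,\cdot\rangle_{\mathcal G}=-\frac{4}{(z_1-z_2)^2}\,dz_1dz_2$ for an affine coordinate $z$ that is finite at both endpoints; here $dz_1dz_2=\tfrac12(dz_1\otimes dz_2+dz_2\otimes dz_1)$. Let $Mat(2,\mathbb C)$ carry $\langle M,N\rangle_{Mat_2}=\tfrac12\big(\operatorname{tr}(MN)-\operatorname{tr}M\operatorname{tr}N\big)$,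 and let $$F:\mathbb C^4\to Mat(2,\mathbb C),\qquad F(z_1,z_2,z_3,z_4)=\begin{pmatrix}-z_1-iz_4&-z_2-iz_3\\-z_2+iz_3&z_1-iz_4\end{pmatrix}.$$ A holomorphic Riemannian metric is a field of symmetric, non-degenerate, complex bilinear forms on the tangent spaces that is holomorphic on local holomorphic vector fields; an isometry (local isometry) is a biholomorphism (local biholomorphism) that pulls one metric back to the other. Then: 1. The forms above on $\mathbb X_3$, $\mathbb X_2$, $SL(2,\mathbb C)$, $PSL(2,\mathbb C)$, $SL(2,\mathbb C)\cap\mathfrak{sl}_2$, $Q$ and $\mathcal G$ are holomorphic Riemannian metrics, and $\langle\cdot,\cdot\rangle_{\mathcal G}$ is given by the same formula in every affine coordinate $z\circ A$, $A\in SL(2,\mathbb C)$, that is finite at both endpoints. 2. $\langle M,M\rangle_{Mat_2}=-\det M$, and $F$ is a linear isometric isomorphism from $(\mathbb C^4,\langle\cdot,\cdot\rangle)$ onto $(Mat(2,\mathbb C),\langle\cdot,\cdot\rangle_{Mat_2})$. 3. $F$ restricts to an isometry from $\mathbb X_3$ onto $SL(2,\mathbb C)$. 4. $F$ maps $\{z\in\mathbb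 C^4: z_4=0,\ \sum_k z_k^2=-1\}$ onto $SL(2,\mathbb C)\cap\mathfrak{sl}_2$, and $z\mapsto F(z_1,z_2,z_3,0)$ is an isometry from $\mathbb X_2$ onto $SL(2,\mathbb C)\cap\mathfrak{sl}_2$. 5. The inclusion $Q\subset PSL(2,\mathbb C)$ is holomorphic, and the projection $SL(2,\mathbb C)\cap\mathfrak{sl}_2\to Q$ is a local isometry and a two-sheeted covering. 6. For every $\gamma\in\mathcal G$ there is exactly one element $Rot_\pi(\gamma)$ of $PSL(2,\mathbb C)$ that acts on $\mathbb H^3$ as the rotation of angle $\pi$ around $\gamma$; it lies in $Q$, and $Rot_\pi:\mathcal G\to Q$ is a local isometry and a two-sheeted covering. 7. There is an isometry $\Theta:\mathbb X_2\to\mathcal G$ such that $Rot_\pi(\Theta(z))$ is the class of $F(z_1,z_2,z_3,0)$ in $PSL(2,\mathbb C)$ for all $z\in\mathbb X_2$. In particular $\mathbb X_2\cong\mathcal G$ as holomorphic Riemannian manifolds. -/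

import Mathlib

open Set Topology Module
open scoped Manifold ContDiff MatrixGroups

noncomputable section

section LevelSets

variable {V W M : Type*} [NormedAddCommGroup V] [NormedSpace ℂ V] [FiniteDimensional ℂ V]
  [NormedAddCommGroup W] [NormedSpace ℂ W] [FiniteDimensional ℂ W] [TopologicalSpace M]

/-- `ι` identifies the space `M` with the zero set of the holomorphic map `f : V → W`, all of whose
points are regular, and the zero set has complex dimension `n`. -/
structure IsRegularLevelSet (ι : M → V) (f : V → W) (n : ℕ) : Prop where
  isEmbedding : IsEmbedding ι
  range_eq : range ι = f ⁻¹' {0}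
  contDiff : ContDiff ℂ ω f
  surjective_fderiv : ∀ p, Function.Surjective (fderiv ℂ f (ι p))
  finrank_eq : finrank ℂ V = finrank ℂ W + n

theorem exists_straightening {n : ℕ} (f' : V →L[ℂ] W) (hf : Function.Surjective f')
    (h : finrank ℂ V = finrank ℂ W + n) :
    ∃ e : V ≃L[ℂ] W × (Fin n → ℂ), ∀ v, (e v).1 = f' v := by
  have hk : finrank ℂ f'.ker = finrank ℂ (Fin n → ℂ) := by
    have := f'.toLinearMap.finrank_range_add_finrank_ker
    rw [LinearMap.range_eq_top.2 hf, finrank_top, h] at this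
    simp only [finrank_fin_fun]
    exact Nat.add_left_cancel this
  let k : f'.ker ≃ₗ[ℂ] (Fin n → ℂ) := LinearEquiv.ofFinrankEq _ _ hk
  obtain ⟨g, hg⟩ := (f'.ker.subtype).exists_leftInverse_of_injective
    (by simp)
  let m : V →ₗ[ℂ] W × (Fin n → ℂ) := f'.toLinearMap.prod (k.toLinearMap ∘ₗ g)
  have hm : Function.Injective m := by
    rw [← LinearMap.ker_eq_bot, LinearMap.ker_eq_bot']
    intro v hv
    have h1 : f' v = 0 := congrArg Prod.fst hv
    have h2 : k (g v) = 0 := congrArg Prod.snd hv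
    have h3 : g v = 0 := by simpa using h2
    have h4 := LinearMap.congr_fun hg ⟨v, h1⟩
    have h5 : (⟨v, h1⟩ : f'.ker) = 0 := by
      rw [← h3]; exact h4.symm
    exact congrArg Subtype.val h5
  have hd : finrank ℂ V = finrank ℂ (W × (Fin n → ℂ)) := by simp [h]
  have hs := (LinearMap.injective_iff_surjective_of_finrank_eq_finrank hd).1 hm
  exact ⟨(LinearEquiv.ofBijective m ⟨hm, hs⟩).toContinuousLinearEquiv, fun v => rfl⟩

theorem IsRegularLevelSet.apply_eq_zero {V W M : Type*} [NormedAddCommGroup V] [NormedSpace ℂ V]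
    [NormedAddCommGroup W] [NormedSpace ℂ W] [TopologicalSpace M] {ι : M → V} {f : V → W} {n : ℕ}
    (h : IsRegularLevelSet ι f n) (q : M) : f (ι q) = 0 := by
  have : ι q ∈ f ⁻¹' {0} := h.range_eq ▸ mem_range_self q
  exact this

namespace IsRegularLevelSet

variable {ι : M → V} {f : V → W} {n : ℕ} (h : IsRegularLevelSet ι f n)

/-- A linear isomorphism `V ≃ W × ℂⁿ` whose first component is the derivative of `f` at `p`. -/
def straightening (p : M) : V ≃L[ℂ] W × (Fin n → ℂ) :=
  (exists_straightening (fderiv ℂ f (ι p)) (h.surjective_fderiv p) h.finrank_eq).choose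

theorem straightening_fst (p : M) (v : V) :
    (h.straightening p v).1 = fderiv ℂ f (ι p) v :=
  (exists_straightening (fderiv ℂ f (ι p)) (h.surjective_fderiv p) h.finrank_eq).choose_spec v

/-- The map `x ↦ (f x, second component of the straightening of x)`. -/
def ambient (p : M) (x : V) : W × (Fin n → ℂ) := (f x, (h.straightening p x).2)

theorem contDiff_ambient (p : M) : ContDiff ℂ ω (h.ambient p) :=
  h.contDiff.prodMk (contDiff_snd.comp (h.straightening p).contDiff)

theorem hasFDerivAt_ambient (p : M) :
    HasFDerivAt (h.ambient p) (h.straightening p : V →L[ℂ] W × (Fin n → ℂ)) (ι p) := by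
  have h1 : HasFDerivAt f (fderiv ℂ f (ι p)) (ι p) :=
    (h.contDiff.differentiable (by simp) (ι p)).hasFDerivAt
  have h2 : HasFDerivAt (fun x => (h.straightening p x).2)
      ((ContinuousLinearMap.snd ℂ W (Fin n → ℂ)).comp
        (h.straightening p : V →L[ℂ] W × (Fin n → ℂ))) (ι p) :=
    ((ContinuousLinearMap.snd ℂ W (Fin n → ℂ)).comp
      (h.straightening p : V →L[ℂ] W × (Fin n → ℂ))).hasFDerivAt
  have h3 : (h.straightening p : V →L[ℂ] W × (Fin n → ℂ)) = (fderiv ℂ f (ι p)).prod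
      ((ContinuousLinearMap.snd ℂ W (Fin n → ℂ)).comp
        (h.straightening p : V →L[ℂ] W × (Fin n → ℂ))) :=
    ContinuousLinearMap.ext fun v => Prod.ext (h.straightening_fst p v) rfl
  rw [h3]
  exact h1.prodMk h2

/-- The local biholomorphism of `V` with `W × ℂⁿ` around `ι p` given by `ambient`. -/
def ambientHomeo (p : M) : OpenPartialHomeomorph V (W × (Fin n → ℂ)) :=
  ((h.contDiff_ambient p).contDiffAt.toOpenPartialHomeomorph (h.ambient p)
    (h.hasFDerivAt_ambient p) (by simp)).restrContDiff ℂ ω (by simp)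

theorem ambientHomeo_apply (p : M) (x : V) : h.ambientHomeo p x = h.ambient p x := rfl

theorem mem_ambientHomeo_source (p : M) : ι p ∈ (h.ambientHomeo p).source :=
  ⟨(h.contDiff_ambient p).contDiffAt.mem_toOpenPartialHomeomorph_source
      (h.hasFDerivAt_ambient p) (by simp),
    (h.contDiff_ambient p).contDiffAt,
    (h.contDiff_ambient p).contDiffAt.to_localInverse (h.hasFDerivAt_ambient p) (by simp)⟩

theorem contDiffOn_ambientHomeo_symm (p : M) :
    ContDiffOn ℂ ω (h.ambientHomeo p).symm (h.ambientHomeo p).target :=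
  OpenPartialHomeomorph.contDiffOn_restrContDiff_target ℂ _ _

theorem ambient_apply (p q : M) : h.ambient p (ι q) = (0, (h.straightening p (ι q)).2) := by
  simp [ambient, h.apply_eq_zero]

theorem exists_preimage (p : M) {k : Fin n → ℂ} (hk : ((0 : W), k) ∈ (h.ambientHomeo p).target) :
    ∃ q : M, ι q = (h.ambientHomeo p).symm (0, k) := by
  have h1 : h.ambient p ((h.ambientHomeo p).symm (0, k)) = (0, k) :=
    (h.ambientHomeo p).right_inv hk
  have h2 : (h.ambientHomeo p).symm (0, k) ∈ f ⁻¹' {0} := congrArg Prod.fst h1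
  rw [← h.range_eq] at h2
  exact h2

open Classical in
/-- The inverse of the chart at `p`. -/
def chartInv (p : M) (k : Fin n → ℂ) : M :=
  if hk : ((0 : W), k) ∈ (h.ambientHomeo p).target then (h.exists_preimage p hk).choose else p

theorem apply_chartInv (p : M) {k : Fin n → ℂ}
    (hk : ((0 : W), k) ∈ (h.ambientHomeo p).target) :
    ι (h.chartInv p k) = (h.ambientHomeo p).symm (0, k) := by
  rw [chartInv, dif_pos hk]
  exact (h.exists_preimage p hk).choose_spec

/-- The chart at `p`: the restriction to the level set of the local biholomorphism `ambient`. -/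
def chart (p : M) : OpenPartialHomeomorph M (Fin n → ℂ) where
  toFun q := (h.straightening p (ι q)).2
  invFun := h.chartInv p
  source := ι ⁻¹' (h.ambientHomeo p).source
  target := {k | ((0 : W), k) ∈ (h.ambientHomeo p).target}
  map_source' q hq := by
    have := (h.ambientHomeo p).map_source hq
    rwa [ambientHomeo_apply, ambient_apply] at this
  map_target' k hk := by
    rw [mem_preimage, h.apply_chartInv p hk]
    exact (h.ambientHomeo p).map_target hk
  left_inv' q hq := by
    have h1 := (h.ambientHomeo p).map_source hq
    rw [ambientHomeo_apply, ambient_apply] at h1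
    apply h.isEmbedding.injective
    rw [h.apply_chartInv p h1, ← h.ambient_apply p q]
    exact (h.ambientHomeo p).left_inv hq
  right_inv' k hk := by
    have h1 : h.ambient p ((h.ambientHomeo p).symm (0, k)) = (0, k) :=
      (h.ambientHomeo p).right_inv hk
    rw [h.apply_chartInv p hk]
    exact congrArg Prod.snd h1
  open_source := (h.ambientHomeo p).open_source.preimage h.isEmbedding.continuous
  open_target := (h.ambientHomeo p).open_target.preimage (by fun_prop)
  continuousOn_toFun := by
    have := h.isEmbedding.continuous
    fun_prop
  continuousOn_invFun := by
    rw [h.isEmbedding.continuousOn_iff]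
    refine ContinuousOn.congr (f := fun k => (h.ambientHomeo p).symm (0, k)) ?_
      (fun k hk => h.apply_chartInv p hk)
    exact (h.ambientHomeo p).continuousOn_symm.comp (by fun_prop) (fun k hk => hk)

/-- The complex submanifold structure of a regular level set. -/
@[reducible] def chartedSpace : ChartedSpace (Fin n → ℂ) M where
  atlas := range h.chart
  chartAt := h.chart
  mem_chart_source p := h.mem_ambientHomeo_source p
  chart_mem_atlas p := mem_range_self p

theorem contDiffOn_chart_symm (p : M) :
    ContDiffOn ℂ ω (fun k => ι ((h.chart p).symm k)) (h.chart p).target := by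
  refine ContDiffOn.congr (f := fun k => (h.ambientHomeo p).symm (0, k)) ?_
      (fun k hk => h.apply_chartInv p hk)
  exact (h.contDiffOn_ambientHomeo_symm p).comp (by fun_prop) (fun k hk => hk)

theorem isManifold : letI := h.chartedSpace; IsManifold 𝓘(ℂ, Fin n → ℂ) ω M := by
  let := h.chartedSpace
  apply isManifold_of_contDiffOn
  rintro e e' ⟨p, rfl⟩ ⟨q, rfl⟩
  have h1 : ContDiff ℂ ω (fun x => (h.straightening q x).2) :=
    contDiff_snd.comp (h.straightening q).contDiff
  refine (h1.comp_contDiffOn (h.contDiffOn_chart_symm p)).mono ?_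
  intro k hk
  have := hk.1
  simp only [mfld_simps] at this
  exact this.1

theorem contMDiff_val : letI := h.chartedSpace
    ContMDiff 𝓘(ℂ, Fin n → ℂ) 𝓘(ℂ, V) ω ι := by
  let := h.chartedSpace
  intro p
  rw [contMDiffAt_iff]
  refine ⟨h.isEmbedding.continuous.continuousAt, ?_⟩
  have h1 : ContDiffOn ℂ ω (fun k => ι ((h.chart p).symm k)) (h.chart p).target :=
    h.contDiffOn_chart_symm p
  have h2 : (h.chart p).target ∈ 𝓝 (h.chart p p) :=
    (h.chart p).open_target.mem_nhds ((h.chart p).map_source (h.mem_ambientHomeo_source p))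
  exact (h1.contDiffAt h2).contDiffWithinAt

theorem contMDiff_of_comp {E H N : Type*} [NormedAddCommGroup E] [NormedSpace ℂ E]
    [TopologicalSpace H] {I : ModelWithCorners ℂ E H} [TopologicalSpace N] [ChartedSpace H N]
    {g : N → M} (hg : ContMDiff I 𝓘(ℂ, V) ω (fun x => ι (g x))) : letI := h.chartedSpace
    ContMDiff I 𝓘(ℂ, Fin n → ℂ) ω g := by
  let := h.chartedSpace
  intro x
  have hc : Continuous g := h.isEmbedding.continuous_iff.2 hg.continuous
  rw [contMDiffAt_iff_target]
  refine ⟨hc.continuousAt, ?_⟩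
  have h1 : ContDiff ℂ ω (fun y => (h.straightening (g x) y).2) :=
    contDiff_snd.comp (h.straightening (g x)).contDiff
  exact h1.contMDiff.contMDiffAt.comp x hg.contMDiffAt

end IsRegularLevelSet

end LevelSets

section Quotients

variable {E M N : Type*} [NormedAddCommGroup E] [NormedSpace ℂ E]
  [TopologicalSpace M] [ChartedSpace E M] [TopologicalSpace N]

/-- If the fibres of a surjective local homeomorphism `π : M → N` are permuted by holomorphic maps,
the charts of `M` descend to a holomorphic atlas of `N`. -/
theorem isManifold_of_isLocalHomeomorph [IsManifold 𝓘(ℂ, E) ω M] {π : M → N}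
    (hπ : IsLocalHomeomorph π) (hs : Function.Surjective π)
    (hdeck : ∀ x y, π x = π y → ∃ τ : M → M, ContMDiff 𝓘(ℂ, E) 𝓘(ℂ, E) ω τ ∧ τ x = y ∧
      ∀ z, π (τ z) = π z) :
    letI : ChartedSpace E N := hπ.chartedSpace hs
    IsManifold 𝓘(ℂ, E) ω N := by
  let : ChartedSpace E N := hπ.chartedSpace hs
  apply isManifold_of_contDiffOn
  rintro e e' ⟨p, rfl⟩ ⟨q, rfl⟩
  generalize hs.hasRightInverse.choose p = x
  generalize hs.hasRightInverse.choose q = y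
  rintro k ⟨hk, -⟩
  simp only [mfld_simps, hπ.localInverseAt_symm] at hk
  obtain ⟨⟨hk1, hk2⟩, hk3, hk4⟩ := hk
  have hk3' : π ((chartAt E x).symm k) ∈ (hπ.localInverseAt y).source := hk3
  obtain ⟨τ, hτ, hτm, hτπ⟩ := hdeck ((chartAt E x).symm k)
    (hπ.localInverseAt y (π ((chartAt E x).symm k)))
    (hπ.apply_localInverseAt_of_mem hk3').symm
  have h1 : ContMDiffAt 𝓘(ℂ, E) 𝓘(ℂ, E) ω (chartAt E x).symm k :=
    (contMDiffOn_chart_symm (I := 𝓘(ℂ, E)) (x := x)).contMDiffAt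
      ((chartAt E x).open_target.mem_nhds hk1)
  have h1τ : ContMDiffAt 𝓘(ℂ, E) 𝓘(ℂ, E) ω (fun z => τ ((chartAt E x).symm z)) k :=
    hτ.contMDiffAt.comp k h1
  have h2 : ContMDiffAt 𝓘(ℂ, E) 𝓘(ℂ, E) ω (chartAt E y) (τ ((chartAt E x).symm k)) :=
    (contMDiffOn_chart (I := 𝓘(ℂ, E)) (x := y)).contMDiffAt
      ((chartAt E y).open_source.mem_nhds (by rw [hτm]; exact hk4))
  have h3 : ContDiffAt ℂ ω (fun z => chartAt E y (τ ((chartAt E x).symm z))) k :=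
    contMDiffAt_iff_contDiffAt.1 (h2.comp k h1τ)
  refine (h3.congr_of_eventuallyEq ?_).contDiffWithinAt
  have h4 : ∀ᶠ z in 𝓝 k, τ ((chartAt E x).symm z) ∈ (hπ.localInverseAt y).target :=
    h1τ.continuousAt.eventually_mem ((hπ.localInverseAt y).open_target.mem_nhds
      (by rw [hτm]; exact (hπ.localInverseAt y).map_source hk3'))
  filter_upwards [h4] with z hz
  have h5 : hπ.localInverseAt y (π (τ ((chartAt E x).symm z))) = τ ((chartAt E x).symm z) := by
    have := (hπ.localInverseAt y).right_inv hz
    rwa [hπ.localInverseAt_symm] at this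
  rw [hτπ] at h5
  simp only [mfld_simps, hπ.localInverseAt_symm]
  exact congrArg _ h5

end Quotients

section RiemannSphere

/-- The inversion `z ↦ 1 / z` of the Riemann sphere `ℂ ∪ {∞}`, exchanging `0` and `∞`. -/
def sphereInv : OnePoint ℂ → OnePoint ℂ
  | OnePoint.infty => ((0 : ℂ) : OnePoint ℂ)
  | (z : ℂ) => if z = 0 then OnePoint.infty else ((z⁻¹ : ℂ) : OnePoint ℂ)

theorem sphereInv_infty : sphereInv OnePoint.infty = ((0 : ℂ) : OnePoint ℂ) := rfl

theorem sphereInv_zero : sphereInv ((0 : ℂ) : OnePoint ℂ) = OnePoint.infty := if_pos rfl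

theorem sphereInv_coe {z : ℂ} (hz : z ≠ 0) :
    sphereInv (z : OnePoint ℂ) = ((z⁻¹ : ℂ) : OnePoint ℂ) := if_neg hz

theorem sphereInv_sphereInv (x : OnePoint ℂ) : sphereInv (sphereInv x) = x := by
  induction x using OnePoint.rec with
  | infty => rw [sphereInv_infty, sphereInv_zero]
  | coe z =>
    by_cases hz : z = 0
    · rw [hz, sphereInv_zero, sphereInv_infty]
    · rw [sphereInv_coe hz, sphereInv_coe (inv_ne_zero hz), inv_inv]

theorem continuous_sphereInv : Continuous sphereInv := by
  rw [OnePoint.continuous_iff]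
  constructor
  · rw [sphereInv_infty, Filter.coclosedCompact_eq_cocompact, ← Metric.cobounded_eq_cocompact]
    have h1 : Filter.Tendsto (fun z : ℂ => ((z⁻¹ : ℂ) : OnePoint ℂ)) (Bornology.cobounded ℂ)
        (𝓝 ((0 : ℂ) : OnePoint ℂ)) :=
      (OnePoint.continuous_coe.tendsto 0).comp Filter.tendsto_inv₀_cobounded
    refine h1.congr' ?_
    filter_upwards [Bornology.eventually_ne_cobounded (0 : ℂ)] with z hz
    exact (sphereInv_coe hz).symm
  · rw [continuous_iff_continuousAt]
    intro z
    by_cases hz : z = 0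
    · subst hz
      rw [← continuousWithinAt_compl_self]
      have h1 : Filter.Tendsto (fun z : ℂ => ((z⁻¹ : ℂ) : OnePoint ℂ)) (𝓝[≠] 0)
          (𝓝 OnePoint.infty) := by
        have h2 : Filter.Tendsto ((↑) : ℂ → OnePoint ℂ) (Bornology.cobounded ℂ) (𝓝 OnePoint.infty) := by
          have := OnePoint.tendsto_coe_infty (X := ℂ)
          rwa [Filter.coclosedCompact_eq_cocompact, ← Metric.cobounded_eq_cocompact] at this
        exact h2.comp Filter.tendsto_inv₀_nhdsNE_zero
      rw [ContinuousWithinAt, sphereInv_zero]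
      refine h1.congr' ?_
      filter_upwards [self_mem_nhdsWithin] with z hz
      exact (sphereInv_coe hz).symm
    · have h1 : ContinuousAt (fun z : ℂ => ((z⁻¹ : ℂ) : OnePoint ℂ)) z :=
        OnePoint.continuous_coe.continuousAt.comp (continuousAt_inv₀ hz)
      refine h1.congr ?_
      filter_upwards [isOpen_ne.mem_nhds hz] with w hw
      exact (sphereInv_coe hw).symm

/-- The inversion as a homeomorphism. -/
def sphereInvHomeo : OnePoint ℂ ≃ₜ OnePoint ℂ where
  toFun := sphereInv
  invFun := sphereInv
  left_inv := sphereInv_sphereInv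
  right_inv := sphereInv_sphereInv
  continuous_toFun := continuous_sphereInv
  continuous_invFun := continuous_sphereInv

/-- The affine chart `z` of the Riemann sphere, defined away from `∞`. -/
def sphereChartZero : OpenPartialHomeomorph (OnePoint ℂ) ℂ :=
  (OnePoint.isOpenEmbedding_coe.toOpenPartialHomeomorph ((↑) : ℂ → OnePoint ℂ)).symm

/-- The affine chart `1 / z` of the Riemann sphere, defined away from `0`. -/
def sphereChartInfty : OpenPartialHomeomorph (OnePoint ℂ) ℂ :=
  sphereInvHomeo.toOpenPartialHomeomorph.trans sphereChartZero

theorem sphereChartZero_source : sphereChartZero.source = range ((↑) : ℂ → OnePoint ℂ) := by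
  simp [sphereChartZero]

theorem sphereChartZero_symm_apply (z : ℂ) : sphereChartZero.symm z = (z : OnePoint ℂ) := rfl

theorem sphereChartZero_coe (z : ℂ) : sphereChartZero (z : OnePoint ℂ) = z :=
  sphereChartZero.right_inv (x := z) (by simp [sphereChartZero])

theorem sphereChartInfty_source :
    sphereChartInfty.source = sphereInv ⁻¹' range ((↑) : ℂ → OnePoint ℂ) := by
  rw [sphereChartInfty, OpenPartialHomeomorph.trans_source, sphereChartZero_source]
  exact univ_inter _

theorem sphereChartInfty_apply (x : OnePoint ℂ) :
    sphereChartInfty x = sphereChartZero (sphereInv x) := rfl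

theorem sphereChartInfty_symm_apply (z : ℂ) :
    sphereChartInfty.symm z = sphereInv (z : OnePoint ℂ) := rfl

/-- The standard holomorphic atlas `{z, 1 / z}` of the Riemann sphere. -/
instance : ChartedSpace ℂ (OnePoint ℂ) where
  atlas := {sphereChartZero, sphereChartInfty}
  chartAt x := x.elim sphereChartInfty (fun _ => sphereChartZero)
  mem_chart_source x := by
    induction x using OnePoint.rec with
    | infty =>
      rw [OnePoint.elim_infty, sphereChartInfty_source]
      exact ⟨0, rfl⟩
    | coe z =>
      rw [OnePoint.elim_some, sphereChartZero_source]
      exact ⟨z, rfl⟩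
  chart_mem_atlas x := by
    induction x using OnePoint.rec with
    | infty => exact Or.inr rfl
    | coe z => exact Or.inl rfl

theorem contDiffWithinAt_sphereInv {s : Set ℂ} {z : ℂ}
    (hz : sphereInv (z : OnePoint ℂ) ∈ range ((↑) : ℂ → OnePoint ℂ)) :
    ContDiffWithinAt ℂ ω (fun w : ℂ => sphereChartZero (sphereInv (w : OnePoint ℂ))) s z := by
  have h0 : z ≠ 0 := by
    rintro rfl
    obtain ⟨w, hw⟩ := hz
    rw [sphereInv_zero] at hw
    exact OnePoint.coe_ne_infty w hw
  refine ((contDiffAt_inv ℂ h0).congr_of_eventuallyEq ?_).contDiffWithinAt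
  filter_upwards [isOpen_ne.mem_nhds h0] with w hw
  rw [sphereInv_coe hw, sphereChartZero_coe]

instance : IsManifold 𝓘(ℂ) ω (OnePoint ℂ) := by
  apply isManifold_of_contDiffOn
  rintro e e' (rfl | rfl) (rfl | rfl) z ⟨hz, -⟩
  · exact contDiffWithinAt_id.congr_of_mem (fun w _ => sphereChartZero_coe w)
      ⟨hz, z, rfl⟩
  · have h1 : (z : OnePoint ℂ) ∈ sphereChartInfty.source := hz.2
    rw [sphereChartInfty_source] at h1
    exact contDiffWithinAt_sphereInv h1
  · have h1 : sphereInv (z : OnePoint ℂ) ∈ sphereChartZero.source := hz.2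
    rw [sphereChartZero_source] at h1
    exact contDiffWithinAt_sphereInv h1
  · refine contDiffWithinAt_id.congr_of_mem (fun w _ => ?_) ⟨hz, z, rfl⟩
    change sphereChartZero (sphereInv (sphereInv (w : OnePoint ℂ))) = w
    rw [sphereInv_sphereInv, sphereChartZero_coe]

end RiemannSphere

/-- The space `Mat(2, ℂ)`. -/
abbrev Mat2 : Type := Matrix (Fin 2) (Fin 2) ℂ

/-- The underlying normed space `ℂ²ˣ²` of `Mat(2, ℂ)`, as an ambient complex manifold. -/
abbrev Mat2Space : Type := Fin 2 → Fin 2 → ℂ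

/-- The quadric `𝕏ₙ = {z ∈ ℂⁿ⁺¹ | ∑ zᵢ² = -1}`. -/
abbrev Quadric (n : ℕ) : Type := {z : Fin (n + 1) → ℂ // ∑ i, z i ^ 2 = -1}

theorem fderiv_apply_eq_of_hasDerivAt {V W : Type*} [NormedAddCommGroup V] [NormedSpace ℂ V]
    [NormedAddCommGroup W] [NormedSpace ℂ W] {f : V → W} (hf : ContDiff ℂ ω f) {p v : V} {w : W}
    (h : HasDerivAt (fun t : ℂ => f (p + t • v)) w 0) : fderiv ℂ f p v = w :=
  HasLineDerivAt.unique
    ((hf.differentiable (by simp) p).hasFDerivAt.hasLineDerivAt v) h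

theorem quadric_isRegularLevelSet (n : ℕ) :
    IsRegularLevelSet (M := Quadric n) Subtype.val
      (fun z : Fin (n + 1) → ℂ => ∑ i, z i ^ 2 + 1) n where
  isEmbedding := .subtypeVal
  range_eq := by
    ext z
    simp [eq_neg_iff_add_eq_zero]
  contDiff := by fun_prop
  surjective_fderiv p := by
    have h : fderiv ℂ (fun z : Fin (n + 1) → ℂ => ∑ i, z i ^ 2 + 1) p.1 p.1 = -2 := by
      apply fderiv_apply_eq_of_hasDerivAt (by fun_prop)
      have h1 : (fun t : ℂ => ∑ i, (p.1 + t • p.1) i ^ 2 + 1) = fun t => 1 - (1 + t) ^ 2 := by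
        funext t
        have h2 : ∀ i, (p.1 + t • p.1) i ^ 2 = (1 + t) ^ 2 * p.1 i ^ 2 := fun i => by
          simp only [Pi.add_apply, Pi.smul_apply, smul_eq_mul]
          ring
        simp only [h2, ← Finset.mul_sum, p.2]
        ring
      rw [h1]
      have h3 : HasDerivAt (fun t : ℂ => 1 - (1 + t) ^ 2) (-(2 * (1 + 0) ^ 1 * 1)) 0 := by
        simpa using (((hasDerivAt_id (0 : ℂ)).const_add 1).pow 2).const_sub 1
      simpa using h3
    intro c
    refine ⟨(-c / 2) • p.1, ?_⟩
    rw [map_smul, h, smul_eq_mul]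
    ring
  finrank_eq := by simp [add_comm]

instance (n : ℕ) : ChartedSpace (Fin n → ℂ) (Quadric n) :=
  (quadric_isRegularLevelSet n).chartedSpace

instance (n : ℕ) : IsManifold 𝓘(ℂ, Fin n → ℂ) ω (Quadric n) :=
  (quadric_isRegularLevelSet n).isManifold

/-- The determinant on the ambient space. -/
def det2 (A : Mat2Space) : ℂ := A 0 0 * A 1 1 - A 0 1 * A 1 0

/-- The trace on the ambient space. -/
def tr2 (A : Mat2Space) : ℂ := A 0 0 + A 1 1

theorem contDiff_det2 : ContDiff ℂ ω det2 := by
  unfold det2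
  fun_prop

theorem contDiff_tr2 : ContDiff ℂ ω tr2 := by
  unfold tr2
  fun_prop

/-- The inclusion of `SL(2, ℂ)` in `Mat(2, ℂ)`. -/
def slMat (A : SL(2, ℂ)) : Mat2Space := fun i j => A.1 i j

theorem isEmbedding_slMat : IsEmbedding slMat := .subtypeVal

theorem det2_slMat (A : SL(2, ℂ)) : det2 (slMat A) = 1 :=
  (Matrix.det_fin_two A.1).symm.trans A.2

theorem tr2_slMat (A : SL(2, ℂ)) : tr2 (slMat A) = A.1.trace := (Matrix.trace_fin_two A.1).symm

theorem exists_slMat_eq {A : Mat2Space} (hA : det2 A = 1) : ∃ B : SL(2, ℂ), slMat B = A :=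
  ⟨⟨Matrix.of A, (Matrix.det_fin_two _).trans hA⟩, rfl⟩

theorem contDiff_det2_sub : ContDiff ℂ ω (fun A => det2 A - 1) := contDiff_det2.sub contDiff_const

theorem hasDerivAt_det2_self {A : Mat2Space} (hA : det2 A = 1) :
    HasDerivAt (fun t : ℂ => det2 (A + t • A) - 1) 2 0 := by
  have h1 : (fun t : ℂ => det2 (A + t • A) - 1) = fun t => (1 + t) ^ 2 - 1 := by
    funext t
    rw [det2] at hA ⊢
    simp only [Pi.add_apply, Pi.smul_apply, smul_eq_mul]
    linear_combination (1 + t) ^ 2 * hA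
  rw [h1]
  have h3 : HasDerivAt (fun t : ℂ => (1 + t) ^ 2 - 1) (2 * (1 + 0) ^ 1 * 1) 0 := by
    simpa using (((hasDerivAt_id (0 : ℂ)).const_add 1).pow 2).sub_const 1
  simpa using h3

/-- `SL(2, ℂ)` is the regular level set `det = 1` in `Mat(2, ℂ)`. -/
theorem sl_isRegularLevelSet : IsRegularLevelSet slMat (fun A => det2 A - 1) 3 where
  isEmbedding := isEmbedding_slMat
  range_eq := by
    ext A
    simp only [mem_range, mem_preimage, mem_singleton_iff, sub_eq_zero]
    exact ⟨fun ⟨B, hB⟩ => hB ▸ det2_slMat B, exists_slMat_eq⟩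
  contDiff := contDiff_det2_sub
  surjective_fderiv p := by
    have h : fderiv ℂ (fun A => det2 A - 1) (slMat p) (slMat p) = 2 :=
      fderiv_apply_eq_of_hasDerivAt contDiff_det2_sub (hasDerivAt_det2_self (det2_slMat p))
    intro c
    refine ⟨(c / 2) • slMat p, ?_⟩
    rw [map_smul, h, smul_eq_mul]
    ring
  finrank_eq := by simp [Module.finrank_pi_fintype]

instance : ChartedSpace (Fin 3 → ℂ) SL(2, ℂ) := sl_isRegularLevelSet.chartedSpace

instance : IsManifold 𝓘(ℂ, Fin 3 → ℂ) ω SL(2, ℂ) := sl_isRegularLevelSet.isManifold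

/-- `SL(2, ℂ) ∩ 𝔰𝔩₂`, the matrices of determinant one and trace zero. -/
abbrev SLsl : Type := {A : SL(2, ℂ) // A.1.trace = 0}

/-- `SL(2, ℂ) ∩ 𝔰𝔩₂` is the regular level set `det = 1`, `tr = 0` in `Mat(2, ℂ)`. -/
theorem slsl_isRegularLevelSet : IsRegularLevelSet (M := SLsl) (fun A => slMat A.1)
    (fun A => (det2 A - 1, tr2 A)) 2 where
  isEmbedding := isEmbedding_slMat.comp .subtypeVal
  range_eq := by
    ext A
    simp only [mem_range, mem_preimage, mem_singleton_iff, Prod.mk_eq_zero, sub_eq_zero]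
    constructor
    · rintro ⟨B, rfl⟩
      exact ⟨det2_slMat B.1, (tr2_slMat B.1).trans B.2⟩
    · rintro ⟨h1, h2⟩
      obtain ⟨B, rfl⟩ := exists_slMat_eq h1
      exact ⟨⟨B, (tr2_slMat B).symm.trans h2⟩, rfl⟩
  contDiff := contDiff_det2_sub.prodMk contDiff_tr2
  surjective_fderiv p := by
    have hc : ContDiff ℂ ω (fun A => (det2 A - 1, tr2 A)) := contDiff_det2_sub.prodMk contDiff_tr2
    have hp : det2 (slMat p.1) = 1 := det2_slMat p.1
    have hp' : tr2 (slMat p.1) = 0 := (tr2_slMat p.1).trans p.2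
    generalize slMat p.1 = P at hp hp'
    have h1 : fderiv ℂ (fun A => (det2 A - 1, tr2 A)) P P = (2, 0) := by
      apply fderiv_apply_eq_of_hasDerivAt hc
      refine (hasDerivAt_det2_self hp).prodMk ?_
      have h3 : (fun t : ℂ => tr2 (P + t • P)) = fun _ => 0 := by
        funext t
        rw [tr2] at hp' ⊢
        simp only [Pi.add_apply, Pi.smul_apply, smul_eq_mul]
        linear_combination (1 + t) * hp'
      rw [h3]
      exact hasDerivAt_const _ _
    have h2 : fderiv ℂ (fun A => (det2 A - 1, tr2 A)) P (slMat 1) = (0, 2) := by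
      apply fderiv_apply_eq_of_hasDerivAt hc
      have h3 : (fun t : ℂ => (det2 (P + t • slMat 1) - 1, tr2 (P + t • slMat 1))) =
          fun t => (t ^ 2, t * 2) := by
        funext t
        rw [det2] at hp ⊢
        rw [tr2] at hp' ⊢
        simp only [Pi.add_apply, Pi.smul_apply, smul_eq_mul, slMat,
          Matrix.SpecialLinearGroup.coe_one, Matrix.one_apply_eq,
          Matrix.one_apply_ne (show (0 : Fin 2) ≠ 1 by decide),
          Matrix.one_apply_ne (show (1 : Fin 2) ≠ 0 by decide)]
        refine Prod.ext ?_ ?_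
        · linear_combination hp + t * hp'
        · linear_combination hp'
      rw [h3]
      refine HasDerivAt.prodMk ?_ ?_
      · simpa using (hasDerivAt_id' (0 : ℂ)).fun_pow 2
      · simpa using (hasDerivAt_id' (0 : ℂ)).mul_const 2
    rintro ⟨a, b⟩
    refine ⟨(a / 2) • P + (b / 2) • slMat 1, ?_⟩
    rw [map_add, map_smul, map_smul, h1, h2]
    simp
  finrank_eq := by simp [Module.finrank_pi_fintype]

instance : ChartedSpace (Fin 2 → ℂ) SLsl := slsl_isRegularLevelSet.chartedSpace

instance : IsManifold 𝓘(ℂ, Fin 2 → ℂ) ω SLsl := slsl_isRegularLevelSet.isManifold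

/-- The projection `SL(2, ℂ) → PSL(2, ℂ)`. -/
def toPSL (A : SL(2, ℂ)) : PSL(2, ℂ) := QuotientGroup.mk A

theorem toPSL_eq_iff {A B : SL(2, ℂ)} : toPSL A = toPSL B ↔ B = A ∨ B = -A := by
  rw [toPSL, toPSL, QuotientGroup.eq, Matrix.SpecialLinearGroup.mem_center_iff]
  constructor
  · rintro ⟨r, hr, h⟩
    have h1 : r = 1 ∨ r = -1 := by simpa using hr
    have h2 : B = A * (A⁻¹ * B) := by group
    rcases h1 with rfl | rfl
    · left
      have h3 : A⁻¹ * B = 1 := Subtype.ext (by rw [← h]; simp)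
      rw [h2, h3, mul_one]
    · right
      have h3 : A⁻¹ * B = -1 := Subtype.ext (by rw [← h]; ext i j; fin_cases i <;> fin_cases j <;> simp)
      rw [h2, h3, mul_neg, mul_one]
  · rintro (rfl | rfl)
    · exact ⟨1, by simp, by simp⟩
    · exact ⟨-1, by simp, by rw [mul_neg, inv_mul_cancel]; ext i j; fin_cases i <;> fin_cases j <;> simp⟩

theorem toPSL_surjective : Function.Surjective toPSL := QuotientGroup.mk_surjective

theorem toPSL_isCoveringMap : IsCoveringMap toPSL := by
  refine (Subgroup.isQuotientCoveringMap (Subgroup.center SL(2, ℂ)) ?_).isCoveringMap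
  apply Set.Finite.isDiscrete
  have : (Subgroup.center SL(2, ℂ) : Set SL(2, ℂ)) ⊆ {1, -1} := by
    intro A hA
    have h1 : toPSL 1 = toPSL A := by
      rw [toPSL, toPSL, QuotientGroup.eq]
      simpa using hA
    exact toPSL_eq_iff.1 h1
  exact (Set.toFinite _).subset this

/-- The complex structure of `PSL(2, ℂ)`, the one for which the covering `SL(2, ℂ) → PSL(2, ℂ)` is
locally biholomorphic. -/
instance : ChartedSpace (Fin 3 → ℂ) PSL(2, ℂ) :=
  toPSL_isCoveringMap.isLocalHomeomorph.chartedSpace toPSL_surjective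

theorem contMDiff_neg_SL : ContMDiff 𝓘(ℂ, Fin 3 → ℂ) 𝓘(ℂ, Fin 3 → ℂ) ω
    (fun A : SL(2, ℂ) => -A) := by
  apply sl_isRegularLevelSet.contMDiff_of_comp
  exact (contDiff_neg (𝕜 := ℂ) (F := Mat2Space)).contMDiff.comp sl_isRegularLevelSet.contMDiff_val

instance : IsManifold 𝓘(ℂ, Fin 3 → ℂ) ω PSL(2, ℂ) := by
  refine isManifold_of_isLocalHomeomorph toPSL_isCoveringMap.isLocalHomeomorph toPSL_surjective ?_
  intro x y hxy
  rcases toPSL_eq_iff.1 hxy with rfl | rfl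
  · exact ⟨id, contMDiff_id, rfl, fun _ => rfl⟩
  · exact ⟨fun A => -A, contMDiff_neg_SL, rfl,
      fun z => (toPSL_eq_iff.2 (Or.inr rfl)).symm⟩

/-- `Q = PSL(2, ℂ) ∩ ℙ(𝔰𝔩₂)`, the classes of matrices of determinant one and trace zero. -/
abbrev QSpace : Type := {R : PSL(2, ℂ) // ∃ A : SL(2, ℂ), toPSL A = R ∧ A.1.trace = 0}

/-- The projection `SL(2, ℂ) ∩ 𝔰𝔩₂ → Q`. -/
def toQ (A : SLsl) : QSpace := ⟨toPSL A.1, A.1, rfl, A.2⟩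

theorem toQ_surjective : Function.Surjective toQ := by
  rintro ⟨_, A, rfl, hA⟩
  exact ⟨⟨A, hA⟩, rfl⟩

theorem trace_neg_SL (A : SL(2, ℂ)) : (-A).1.trace = -A.1.trace := Matrix.trace_neg A.1

theorem toQ_isCoveringMap : IsCoveringMap toQ := by
  let s : Set PSL(2, ℂ) := {R | ∃ A : SL(2, ℂ), toPSL A = R ∧ A.1.trace = 0}
  have hs : {A : SL(2, ℂ) | A.1.trace = 0} = toPSL ⁻¹' s := by
    ext A
    constructor
    · exact fun hA => ⟨A, rfl, hA⟩
    · rintro ⟨B, hB, hB'⟩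
      rcases toPSL_eq_iff.1 hB with rfl | rfl
      · exact hB'
      · change (-B).1.trace = 0
        rw [trace_neg_SL, hB', neg_zero]
  exact (toPSL_isCoveringMap.restrictPreimage s).comp_homeomorph (Homeomorph.setCongr hs)

/-- The complex structure of `Q`, the one for which the covering `SL(2, ℂ) ∩ 𝔰𝔩₂ → Q` is locally
biholomorphic; the topology of `Q` is the subspace topology. -/
instance : ChartedSpace (Fin 2 → ℂ) QSpace :=
  toQ_isCoveringMap.isLocalHomeomorph.chartedSpace toQ_surjective

instance : IsManifold 𝓘(ℂ, Fin 2 → ℂ) ω QSpace := by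
  refine isManifold_of_isLocalHomeomorph toQ_isCoveringMap.isLocalHomeomorph toQ_surjective ?_
  rintro ⟨x, hx⟩ ⟨y, hy⟩ hxy
  rcases toPSL_eq_iff.1 (congrArg Subtype.val hxy) with h | h
  · obtain rfl : y = x := h
    exact ⟨id, contMDiff_id, rfl, fun _ => rfl⟩
  · obtain rfl : y = -x := h
    refine ⟨fun A => ⟨-A.1, by rw [trace_neg_SL, A.2, neg_zero]⟩, ?_, rfl,
      fun z => Subtype.ext (toPSL_eq_iff.2 (Or.inr rfl)).symm⟩
    apply slsl_isRegularLevelSet.contMDiff_of_comp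
    exact (contDiff_neg (𝕜 := ℂ) (F := Mat2Space)).contMDiff.comp slsl_isRegularLevelSet.contMDiff_val

/-- The space `𝒢 = ∂ℍ³ × ∂ℍ³ ∖ Δ` of oriented geodesics of hyperbolic space, an oriented geodesic
being given by its ordered pair of distinct endpoints in `∂ℍ³ = ℂ ∪ {∞}`; it is an open subset of
the complex surface `∂ℍ³ × ∂ℍ³`. -/
def geodesicOpens : TopologicalSpace.Opens (OnePoint ℂ × OnePoint ℂ) :=
  ⟨{p | p.1 ≠ p.2}, isOpen_ne_fun continuous_fst continuous_snd⟩

/-- The complex surface of oriented geodesics. -/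
abbrev GSpace : Type := geodesicOpens

/-- A field of complex bilinear forms on the tangent spaces of a complex manifold. -/
abbrev BilinField {E H : Type*} [NormedAddCommGroup E] [NormedSpace ℂ E] [TopologicalSpace H]
    (I : ModelWithCorners ℂ E H) (M : Type*) [TopologicalSpace M] [ChartedSpace H M] : Type _ :=
  ∀ p : M, LinearMap.BilinForm ℂ (TangentSpace I p)

section HolomorphicRiemannian

variable {E H M : Type*} [NormedAddCommGroup E] [NormedSpace ℂ E] [TopologicalSpace H]
  {I : ModelWithCorners ℂ E H} [TopologicalSpace M] [ChartedSpace H M]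
  {E' H' N : Type*} [NormedAddCommGroup E'] [NormedSpace ℂ E'] [TopologicalSpace H']
  {J : ModelWithCorners ℂ E' H'} [TopologicalSpace N] [ChartedSpace H' N]

/-- The pullback of a field of bilinear forms by a map. -/
def BilinField.pullback (g : BilinField J N) (f : M → N) : BilinField I M := fun p =>
  (g (f p)).compl₁₂ (mfderiv I J f p).toLinearMap (mfderiv I J f p).toLinearMap

/-- Holomorphic Riemannian metrics: symmetric nondegenerate complex bilinear forms on the tangent
spaces which take holomorphic values on local holomorphic vector fields. -/
structure IsHolomorphicRiemannian [IsManifold I ω M] (g : BilinField I M) : Prop where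
  symm : ∀ p u v, g p u v = g p v u
  nondegenerate : ∀ p u, (∀ v, g p u v = 0) → u = 0
  holomorphic : ∀ (U : Set M) (X Y : ∀ p : M, TangentSpace I p), IsOpen U →
    ContMDiffOn I I.tangent ω (fun p => (⟨p, X p⟩ : TangentBundle I M)) U →
    ContMDiffOn I I.tangent ω (fun p => (⟨p, Y p⟩ : TangentBundle I M)) U →
    ContMDiffOn I 𝓘(ℂ) ω (fun p => g p (X p) (Y p)) U

/-- An isometry between complex manifolds with metrics `g` and `g'`: a biholomorphism pulling `g'`
back to `g`. -/
def IsIsometry (g : BilinField I M) (g' : BilinField J N) (Φ : Diffeomorph I J M N ω) : Prop :=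
  g'.pullback Φ = g

/-- A local isometry: a local biholomorphism pulling `g'` back to `g`. -/
def IsLocalIsometry (g : BilinField I M) (g' : BilinField J N) (f : M → N) : Prop :=
  IsLocalDiffeomorph I J ω f ∧ g'.pullback f = g

/-- The field of bilinear forms on a group obtained from a form on the tangent space at the identity
by left translations. (Note that `TangentSpace I (g⁻¹ * g)` is the tangent space at `1`.) -/
def leftInvariant {G : Type*} [Group G] [TopologicalSpace G] [ChartedSpace H G]
    (b : LinearMap.BilinForm ℂ (TangentSpace I (1 : G))) : BilinField I G := fun g =>
  let dL : TangentSpace I g →L[ℂ] TangentSpace I (1 : G) := mfderiv I I (fun x => g⁻¹ * x) g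
  b.compl₁₂ dL.toLinearMap dL.toLinearMap

end HolomorphicRiemannian

/-- A bilinear form on a vector space, as a constant field of bilinear forms. -/
def constField {V : Type*} [NormedAddCommGroup V] [NormedSpace ℂ V] (b : LinearMap.BilinForm ℂ V) :
    BilinField 𝓘(ℂ, V) V := fun _ => b

/-- The standard form `⟨v, w⟩ = ∑ vᵢ wᵢ` of `ℂᵐ`. -/
def stdForm (m : ℕ) : LinearMap.BilinForm ℂ (Fin m → ℂ) :=
  LinearMap.mk₂ ℂ (fun v w => ∑ i, v i * w i)
    (fun v v' w => by simp [add_mul, Finset.sum_add_distrib])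
    (fun c v w => by simp [mul_assoc, Finset.mul_sum])
    (fun v w w' => by simp [mul_add, Finset.sum_add_distrib])
    (fun c v w => by simp [mul_left_comm, Finset.mul_sum])

/-- The form `⟨M, N⟩ = (tr (M N) - tr M tr N) / 2` of `Mat(2, ℂ)`. -/
def matForm : LinearMap.BilinForm ℂ Mat2 :=
  LinearMap.mk₂ ℂ (fun M N => 1 / 2 * ((M * N).trace - M.trace * N.trace))
    (fun M M' N => by simp only [add_mul, Matrix.trace_add]; ring)
    (fun c M N => by simp only [Matrix.smul_mul, Matrix.trace_smul, smul_eq_mul]; ring)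
    (fun M N N' => by simp only [mul_add, Matrix.trace_add]; ring)
    (fun c M N => by simp only [Matrix.mul_smul, Matrix.trace_smul, smul_eq_mul]; ring)

/-- The metric of `𝕏ₙ`, induced by the standard form of `ℂⁿ⁺¹`. -/
def quadricMetric (n : ℕ) : BilinField 𝓘(ℂ, Fin n → ℂ) (Quadric n) :=
  (constField (stdForm (n + 1))).pullback Subtype.val

/-- The derivative at the identity of the inclusion of `SL(2, ℂ)` in `Mat(2, ℂ)`. -/
def slMatDeriv : TangentSpace 𝓘(ℂ, Fin 3 → ℂ) (1 : SL(2, ℂ)) →L[ℂ] Mat2Space :=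
  mfderiv 𝓘(ℂ, Fin 3 → ℂ) 𝓘(ℂ, Mat2Space) slMat 1

theorem tr2_slMatDeriv (u : TangentSpace 𝓘(ℂ, Fin 3 → ℂ) (1 : SL(2, ℂ))) :
    tr2 (slMatDeriv u) = 0 := by
  have hf := contDiff_det2_sub
  have h1 : ∀ v : Mat2Space, fderiv ℂ (fun A => det2 A - 1) (slMat 1) v = tr2 v := by
    intro v
    apply fderiv_apply_eq_of_hasDerivAt hf
    have h2 : (fun t : ℂ => det2 (slMat 1 + t • v) - 1) = fun t => t * tr2 v + t ^ 2 * det2 v := by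
      funext t
      simp [det2, tr2, slMat]
      ring
    rw [h2]
    simpa [Pi.add_def] using ((hasDerivAt_id' (0 : ℂ)).mul_const (tr2 v)).add
      (((hasDerivAt_id' (0 : ℂ)).fun_pow 2).mul_const (det2 v))
  have h3 : HasMFDerivAt 𝓘(ℂ, Mat2Space) 𝓘(ℂ) (fun A => det2 A - 1)
      (slMat 1) (fderiv ℂ (fun A => det2 A - (1 : ℂ)) (slMat 1) : Mat2Space →L[ℂ] ℂ) :=
    (hf.differentiable (by simp) (slMat 1)).hasFDerivAt.hasMFDerivAt
  have h4 := ((sl_isRegularLevelSet.contMDiff_val.mdifferentiable (by simp)) 1).hasMFDerivAt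
  have h5 := h3.comp (1 : SL(2, ℂ)) h4
  have h6 : HasMFDerivAt 𝓘(ℂ, Fin 3 → ℂ) 𝓘(ℂ) ((fun A => det2 A - 1) ∘ slMat)
      (1 : SL(2, ℂ)) 0 := by
    have h7 : ((fun A => det2 A - 1) ∘ slMat) = fun _ => 0 := by
      funext A
      exact sub_eq_zero.2 (det2_slMat A)
    rw [h7]
    exact hasMFDerivAt_const _ _
  have h8 := hasMFDerivAt_unique h5 h6
  rw [← h1]
  exact DFunLike.congr_fun h8 u

/-- The identification `T₁ SL(2, ℂ) → 𝔰𝔩₂`, the derivative of the inclusion in `Mat(2, ℂ)`. -/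
def tangentToSl : TangentSpace 𝓘(ℂ, Fin 3 → ℂ) (1 : SL(2, ℂ)) →ₗ[ℂ]
    LieAlgebra.SpecialLinear.sl (Fin 2) ℂ where
  toFun u := ⟨Matrix.of (slMatDeriv u), (Matrix.trace_fin_two _).trans (tr2_slMatDeriv u)⟩
  map_add' u v := Subtype.ext (congrArg Matrix.of (map_add slMatDeriv u v))
  map_smul' c u := Subtype.ext (congrArg Matrix.of (map_smul slMatDeriv c u))

/-- One eighth of the Killing form of `𝔰𝔩₂`, on the tangent space of `SL(2, ℂ)` at the identity. -/
def killingSL : LinearMap.BilinForm ℂ (TangentSpace 𝓘(ℂ, Fin 3 → ℂ) (1 : SL(2, ℂ))) :=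
  (1 / 8 : ℂ) •
    (killingForm ℂ (LieAlgebra.SpecialLinear.sl (Fin 2) ℂ)).compl₁₂ tangentToSl tangentToSl

/-- The metric of `SL(2, ℂ)`: one eighth of the global Killing form. -/
def metricSL : BilinField 𝓘(ℂ, Fin 3 → ℂ) SL(2, ℂ) := leftInvariant killingSL

/-- The inverse of the isomorphism `T₁ SL(2, ℂ) → T₁ PSL(2, ℂ)` induced by the projection. -/
def tangentLift : TangentSpace 𝓘(ℂ, Fin 3 → ℂ) (1 : PSL(2, ℂ)) →L[ℂ]
    TangentSpace 𝓘(ℂ, Fin 3 → ℂ) (1 : SL(2, ℂ)) :=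
  (mfderiv 𝓘(ℂ, Fin 3 → ℂ) 𝓘(ℂ, Fin 3 → ℂ) toPSL 1).inverse

/-- The metric of `PSL(2, ℂ)`: one eighth of the global Killing form. -/
def metricPSL : BilinField 𝓘(ℂ, Fin 3 → ℂ) PSL(2, ℂ) :=
  leftInvariant (killingSL.compl₁₂ tangentLift.toLinearMap tangentLift.toLinearMap)

/-- The metric induced on `SL(2, ℂ) ∩ 𝔰𝔩₂` by `SL(2, ℂ)`. -/
def metricSLsl : BilinField 𝓘(ℂ, Fin 2 → ℂ) SLsl := metricSL.pullback Subtype.val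

/-- The metric induced on `Q` by `PSL(2, ℂ)`. -/
def metricQ : BilinField 𝓘(ℂ, Fin 2 → ℂ) QSpace := metricPSL.pullback Subtype.val

/-- The Möbius action of `SL(2, ℂ)` on `∂ℍ³ = ℂ ∪ {∞}`. -/
def moebius (A : SL(2, ℂ)) (x : OnePoint ℂ) : OnePoint ℂ := Matrix.SpecialLinearGroup.toGL A • x

/-- The affine coordinate `x ↦ A x` of the Riemann sphere (defined where `A x ≠ ∞`). -/
def affineCoord (A : SL(2, ℂ)) (x : OnePoint ℂ) : ℂ := (moebius A x).elim 0 id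

/-- The form `-4 / (z₁ - z₂)² dz₁ dz₂` on `T_γ 𝒢`, where `z` is the affine coordinate given by `A`
and `dz₁ dz₂ = (dz₁ ⊗ dz₂ + dz₂ ⊗ dz₁) / 2`. -/
def affineForm (A : SL(2, ℂ)) : BilinField (𝓘(ℂ).prod 𝓘(ℂ)) GSpace := fun γ =>
  let z₁ : GSpace → ℂ := fun γ => affineCoord A γ.1.1
  let z₂ : GSpace → ℂ := fun γ => affineCoord A γ.1.2
  let dz₁ : TangentSpace (𝓘(ℂ).prod 𝓘(ℂ)) γ →L[ℂ] ℂ :=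
    mfderiv (𝓘(ℂ).prod 𝓘(ℂ)) 𝓘(ℂ) z₁ γ
  let dz₂ : TangentSpace (𝓘(ℂ).prod 𝓘(ℂ)) γ →L[ℂ] ℂ :=
    mfderiv (𝓘(ℂ).prod 𝓘(ℂ)) 𝓘(ℂ) z₂ γ
  (-4 / (z₁ γ - z₂ γ) ^ 2) • (1 / 2 : ℂ) •
    ((LinearMap.mul ℂ ℂ).compl₁₂ dz₁.toLinearMap dz₂.toLinearMap + (LinearMap.mul ℂ ℂ).compl₁₂ dz₂.toLinearMap dz₁.toLinearMap)

theorem exists_affineCoord (γ : GSpace) :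
    ∃ A : SL(2, ℂ), moebius A γ.1.1 ≠ OnePoint.infty ∧ moebius A γ.1.2 ≠ OnePoint.infty := by
  have h : ∃ c : ℂ, (c : OnePoint ℂ) ∉ ({γ.1.1, γ.1.2} : Set (OnePoint ℂ)) := by
    obtain ⟨c, hc⟩ := ((Set.toFinite ({γ.1.1, γ.1.2} : Set (OnePoint ℂ))).preimage
      (OnePoint.coe_injective.injOn (s := ((↑) : ℂ → OnePoint ℂ) ⁻¹' _))).exists_notMem
    exact ⟨c, hc⟩
  obtain ⟨c, hc⟩ := h
  have key : ∀ x : OnePoint ℂ, x ≠ (c : OnePoint ℂ) →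
      moebius ⟨!![0, -1; 1, -c], by simp [Matrix.det_fin_two]⟩ x ≠ OnePoint.infty := by
    intro x hx
    induction x using OnePoint.rec with
    | infty => simp [moebius, OnePoint.smul_infty_eq_ite, Matrix.SpecialLinearGroup.toGL]
    | coe z =>
      have hz : z - c ≠ 0 := sub_ne_zero.2 fun h => hx (by rw [h])
      simpa [moebius, OnePoint.smul_some_eq_ite, Matrix.SpecialLinearGroup.toGL,
        ← sub_eq_add_neg] using hz
  exact ⟨_, key _ fun h => hc (Or.inl h.symm), key _ fun h => hc (Or.inr h.symm)⟩

/-- The metric of `𝒢`: the form `-4 / (z₁ - z₂)² dz₁ dz₂` in an affine coordinate which is finite at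
both endpoints. -/
def metricG : BilinField (𝓘(ℂ).prod 𝓘(ℂ)) GSpace := fun γ =>
  affineForm (exists_affineCoord γ).choose γ

/-- A vector spanning the line of `ℂ²` which corresponds to a point of `∂ℍ³ = ℂ ∪ {∞} = ℂℙ¹`. -/
def boundaryVector (x : OnePoint ℂ) : Fin 2 → ℂ := x.elim ![1, 0] fun z => ![z, 1]

/-- The null vector `v v*` of the space of Hermitian matrices which spans the ray corresponding to a
point of `∂ℍ³`. -/
def boundaryMatrix (x : OnePoint ℂ) : Mat2 :=
  Matrix.vecMulVec (boundaryVector x) (star (boundaryVector x))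

/-- Hyperbolic space `ℍ³` as the hyperboloid of positive definite Hermitian matrices of determinant
one, in the Minkowski space of Hermitian matrices with the quadratic form `-det` (polarized by
`matForm`). An element `A` of `SL(2, ℂ)` acts by the isometry `P ↦ A P A*`, and the boundary at
infinity is the set of null rays. -/
def hyperbolicSpace : Set Mat2 := {P | P.IsHermitian ∧ P.det = 1 ∧ 0 < P.trace.re}

/-- The geodesic line of `ℍ³` with given endpoints: the intersection of `ℍ³` with the plane spanned
by the two endpoints. -/
def geodesicLine (γ : GSpace) : Set Mat2 :=
  {P ∈ hyperbolicSpace |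
    ∃ s t : ℝ, P = (s : ℂ) • boundaryMatrix γ.1.1 + (t : ℂ) • boundaryMatrix γ.1.2}

/-- `R` is the rotation of angle `π` around the line `γ`: it fixes `γ` pointwise and acts as `-1` on
the vectors normal to `γ` (the Hermitian matrices orthogonal to the plane which contains `γ`). -/
def IsPiRotation (γ : GSpace) (R : PSL(2, ℂ)) : Prop :=
  ∃ A : SL(2, ℂ), toPSL A = R ∧ (∀ P ∈ geodesicLine γ, A.1 * P * A.1.conjTranspose = P) ∧
    ∀ X : Mat2, X.IsHermitian → matForm X (boundaryMatrix γ.1.1) = 0 →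
      matForm X (boundaryMatrix γ.1.2) = 0 → A.1 * X * A.1.conjTranspose = -X

/-- The explicit linear map `F : ℂ⁴ → Mat(2, ℂ)`. -/
def mapF : (Fin 4 → ℂ) →ₗ[ℂ] Mat2 where
  toFun z := !![-z 0 - Complex.I * z 3, -z 1 - Complex.I * z 2;
    -z 1 + Complex.I * z 2, z 0 - Complex.I * z 3]
  map_add' z w := by
    ext i j
    fin_cases i <;> fin_cases j <;> simp <;> ring
  map_smul' c z := by
    ext i j
    fin_cases i <;> fin_cases j <;> simp <;> ring

end

/-! Everything reduces to one constant form: the polarization of `-det` on the space of 2×2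
matrices, `detForm`. On `𝔰𝔩₂` the Killing form is 8 times it (`killingForm_sl_apply`), and
multiplication by a matrix of determinant one preserves it (`detForm_mulCLM`). Hence the
left-invariant metric of `SL(2, ℂ)` is the restriction of a constant form (`metricSL_eq_pullback`),
and so is that of `SLsl`. The metrics of the quadrics are of this kind by definition. Such a
restriction is holomorphic, and it is nondegenerate because the tangent spaces are orthogonal
complements of non-isotropic vectors: the position vector, and for `SLsl` also the identity matrix,
which is orthogonal to it. As `F` carries the standard form to `-det`, it restricts to isometries of
the level sets. The metrics of `PSL(2, ℂ)` and `Q` pull back to those upstairs, and the properties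
of a holomorphic Riemannian metric descend along surjective local biholomorphisms
(`IsHolomorphicRiemannian.of_pullback`).

For geodesics, the key map is `geodesicMatrix`. It sends an ordered pair of endpoints, seen as two
lines in `ℂ²`, to the matrix with eigenvalue `i` on the first line and `-i` on the second. It is a
biholomorphism onto `SLsl`, with inverse given by the eigenlines. In an affine coordinate given by
`A`, it is conjugation by `A` of the explicit matrix `affineRotMat (z₁, z₂)`. Conjugation preserves
`detForm`, so the pulled back metric is `-4 / (z₁ - z₂)² dz₁ dz₂` in every such coordinate
(`pullback_geodesicMatrix`); since the pullback does not mention `A`, independence of the coordinate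
comes for free.

Finally, let `v`, `w` span the two lines. The action `P ↦ A P A*` of a matrix with eigenvalues `±i`
on them fixes `v v*` and `w w*`, which span the plane of the geodesic, and is `-1` on `v w*` and `w
v*`, which span the complexified normal plane. Conversely these conditions force the eigenvalues to
be `±i`, so the matrix is determined up to sign. Thus the rotation map is `geodesicMatrix` followed
by the double covering `SLsl → Q`, and `Θ` is `F` on the quadric followed by the inverse of
`geodesicMatrix`. -/

noncomputable section

/-! ### Pullbacks of bilinear fields and descent along local biholomorphisms -/

section Pullback

variable {E H M : Type*} [NormedAddCommGroup E] [NormedSpace ℂ E] [TopologicalSpace H]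
  {I : ModelWithCorners ℂ E H} [TopologicalSpace M] [ChartedSpace H M]
  {E' H' N : Type*} [NormedAddCommGroup E'] [NormedSpace ℂ E'] [TopologicalSpace H']
  {J : ModelWithCorners ℂ E' H'} [TopologicalSpace N] [ChartedSpace H' N]
  {E'' H'' P : Type*} [NormedAddCommGroup E''] [NormedSpace ℂ E''] [TopologicalSpace H'']
  {K : ModelWithCorners ℂ E'' H''} [TopologicalSpace P] [ChartedSpace H'' P]
  {V : Type*} [NormedAddCommGroup V] [NormedSpace ℂ V]

theorem BilinField.pullback_apply (g : BilinField J N) (f : M → N) (p : M)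
    (u v : TangentSpace I p) :
    g.pullback f p u v = g (f p) (mfderiv I J f p u) (mfderiv I J f p v) := rfl

theorem BilinField.pullback_comp (g : BilinField K P) {f' : N → P} {f : M → N}
    (hf' : MDifferentiable J K f') (hf : MDifferentiable I J f) :
    g.pullback (I := I) (f' ∘ f) = (g.pullback (I := J) f').pullback f := by
  funext p
  ext u v
  rw [pullback_apply, pullback_apply, pullback_apply, mfderiv_comp p (hf' _) (hf p)]
  rfl

/-- The tangent map of `f` is holomorphic, and the tangent bundle of `V` is trivial, so `f` turns a
holomorphic vector field into a holomorphic `V`-valued function. A constant bilinear form of two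
such functions is holomorphic. -/
theorem BilinField.contMDiffOn_pullback_constField [FiniteDimensional ℂ V] [IsManifold I ω M]
    (b : LinearMap.BilinForm ℂ V) {f : M → V} (hf : ContMDiff I 𝓘(ℂ, V) ω f) {U : Set M}
    {X Y : ∀ p : M, TangentSpace I p}
    (hX : ContMDiffOn I I.tangent ω (fun p => (⟨p, X p⟩ : TangentBundle I M)) U)
    (hY : ContMDiffOn I I.tangent ω (fun p => (⟨p, Y p⟩ : TangentBundle I M)) U) :
    ContMDiffOn I 𝓘(ℂ) ω (fun p => (constField b).pullback (I := I) f p (X p) (Y p)) U := by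
  have key : ∀ {Z : ∀ p : M, TangentSpace I p},
      ContMDiffOn I I.tangent ω (fun p => (⟨p, Z p⟩ : TangentBundle I M)) U →
      ContMDiffOn I 𝓘(ℂ, V) ω (fun p => (mfderiv I 𝓘(ℂ, V) f p (Z p) : V)) U := fun hZ =>
    (contMDiff_snd_tangentBundle_modelSpace V 𝓘(ℂ, V)).comp_contMDiffOn
      ((hf.contMDiff_tangentMap (m := ω) (by simp)).comp_contMDiffOn hZ)
  let B : V →L[ℂ] V →L[ℂ] ℂ :=
    LinearMap.toContinuousLinearMap (LinearMap.toContinuousLinearMap.toLinearMap ∘ₗ b)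
  have hB : ContDiff ℂ ω (fun x : V × V => B x.1 x.2) := by fun_prop
  exact hB.contMDiff.comp_contMDiffOn ((key hX).prodMk_space (key hY))

theorem IsLocalDiffeomorph.isInvertible_mfderiv {f : M → N} (hf : IsLocalDiffeomorph I J ω f)
    (p : M) : (mfderiv I J f p).IsInvertible :=
  ⟨hf.mfderivToContinuousLinearEquiv (by simp) p, rfl⟩

/-- Near `f p` the map `h` is `h ∘ f` after a local inverse of `f`. This lets holomorphy on a
quotient be tested upstairs. -/
theorem IsLocalDiffeomorph.contMDiffAt_of_comp {f : M → N} (hf : IsLocalDiffeomorph I J ω f)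
    {h : N → P} {p : M} (hh : ContMDiffAt I K ω (h ∘ f) p) : ContMDiffAt J K ω h (f p) := by
  have hp := hf p
  have h1 : ContMDiffAt J K ω ((h ∘ f) ∘ hp.localInverse) (f p) := by
    refine ContMDiffAt.comp (f p) ?_ hp.localInverse_contMDiffAt
    rwa [hp.localInverse_left_inv hp.localInverse_mem_target]
  refine h1.congr_of_eventuallyEq ?_
  filter_upwards [hp.localInverse_eventuallyEq_right] with y hy
  exact (congrArg h hy).symm

/-- Holomorphic Riemannian metrics descend along surjective local biholomorphisms. -/
theorem IsHolomorphicRiemannian.of_pullback [CompleteSpace E] [CompleteSpace E']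
    [IsManifold I ω M] [IsManifold J ω N]
    {f : M → N} (hf : IsLocalDiffeomorph I J ω f) (hs : Function.Surjective f)
    {g : BilinField I M} {g' : BilinField J N} (hg : IsHolomorphicRiemannian g)
    (h : g'.pullback f = g) : IsHolomorphicRiemannian g' := by
  subst h
  have hsurj : ∀ p, Function.Surjective (mfderiv I J f p) := fun p =>
    (hf.mfderivToContinuousLinearEquiv (by simp) p).surjective
  refine ⟨fun q u v => ?_, fun q u hu => ?_, fun U X Y hU hX hY q hq => ?_⟩
  · obtain ⟨p, rfl⟩ := hs q
    obtain ⟨u, rfl⟩ := hsurj p u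
    obtain ⟨v, rfl⟩ := hsurj p v
    exact hg.symm p u v
  · obtain ⟨p, rfl⟩ := hs q
    obtain ⟨u, rfl⟩ := hsurj p u
    rw [hg.nondegenerate p u fun v => hu _, map_zero]
  · obtain ⟨p, rfl⟩ := hs q
    have hfs : ContMDiff I J ω f := hf.contMDiff
    -- Since the derivative of `f` is invertible, vector fields on `N` lift to holomorphic vector
    -- fields on `M`, to which the hypothesis on `g` applies.
    have hX' := hX.mpullback_vectorField_preimage hfs
      (fun x _ => hf.isInvertible_mfderiv x) (m := ω) (by simp)
    have hY' := hY.mpullback_vectorField_preimage hfs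
      (fun x _ => hf.isInvertible_mfderiv x) (m := ω) (by simp)
    have hU' : IsOpen (f ⁻¹' U) := hU.preimage hfs.continuous
    have h1 := hg.holomorphic _ _ _ hU' hX' hY'
    have h2 : ContMDiffAt I 𝓘(ℂ) ω ((fun q => g' q (X q) (Y q)) ∘ f) p := by
      refine (h1.contMDiffAt (hU'.mem_nhds hq)).congr_of_eventuallyEq (.of_forall fun x => ?_)
      have hi := hf.isInvertible_mfderiv x
      change _ = g' (f x) (mfderiv I J f x _) (mfderiv I J f x _)
      rw [VectorField.mpullback_apply, VectorField.mpullback_apply,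
        hi.self_apply_inverse, hi.self_apply_inverse]
      rfl
    exact (hf.contMDiffAt_of_comp h2).contMDiffWithinAt

end Pullback

/-! ### Metrics induced on regular level sets -/

section LevelSetMetrics

variable {V W M : Type*} [NormedAddCommGroup V] [NormedSpace ℂ V] [FiniteDimensional ℂ V]
  [NormedAddCommGroup W] [NormedSpace ℂ W] [FiniteDimensional ℂ W] [TopologicalSpace M]
  {ι : M → V} {f : V → W} {n : ℕ} [cs : ChartedSpace (Fin n → ℂ) M]

/-- The equation `hcs` says that the complex structure in force is the one of the level set; for the
quadrics and the matrix spaces it holds by `rfl`. -/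
theorem IsRegularLevelSet.mdifferentiable (h : IsRegularLevelSet ι f n) (hcs : cs = h.chartedSpace) :
    MDifferentiable 𝓘(ℂ, Fin n → ℂ) 𝓘(ℂ, V) ι := by
  have h1 : ContMDiff 𝓘(ℂ, Fin n → ℂ) 𝓘(ℂ, V) ω ι := by
    subst hcs
    exact h.contMDiff_val
  exact h1.mdifferentiable (by simp)

/-- The chart at `p` is a linear map `g` composed with `ι`, and the derivative of a chart is
invertible. -/
theorem IsRegularLevelSet.mfderiv_injective [IsManifold 𝓘(ℂ, Fin n → ℂ) ω M]
    (h : IsRegularLevelSet ι f n) (hcs : cs = h.chartedSpace) (p : M) :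
    Function.Injective (mfderiv 𝓘(ℂ, Fin n → ℂ) 𝓘(ℂ, V) ι p) := by
  have hι := h.mdifferentiable hcs p
  let g : V →L[ℂ] (Fin n → ℂ) := (ContinuousLinearMap.snd ℂ W (Fin n → ℂ)).comp
    (h.straightening p : V →L[ℂ] W × (Fin n → ℂ))
  have h1 : HasMFDerivAt 𝓘(ℂ, Fin n → ℂ) 𝓘(ℂ, Fin n → ℂ) (g ∘ ι) p
      (g.comp (mfderiv 𝓘(ℂ, Fin n → ℂ) 𝓘(ℂ, V) ι p)) :=
    g.hasFDerivAt.hasMFDerivAt.comp p hι.hasMFDerivAt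
  have h2 : g ∘ ι = extChartAt 𝓘(ℂ, Fin n → ℂ) p := by
    subst hcs
    rfl
  rw [h2] at h1
  have h3 := (isInvertible_mfderiv_extChartAt (I := 𝓘(ℂ, Fin n → ℂ))
    (mem_extChartAt_source (I := 𝓘(ℂ, Fin n → ℂ)) p))
  rw [h1.mfderiv] at h3
  exact Function.Injective.of_comp (f := g) h3.injective

/-- One inclusion comes from differentiating `f ∘ ι = 0`; by regularity and injectivity both spaces
have dimension `n`. This allows nondegeneracy to be checked by linear algebra in `V`. -/
theorem IsRegularLevelSet.range_mfderiv [IsManifold 𝓘(ℂ, Fin n → ℂ) ω M]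
    (h : IsRegularLevelSet ι f n) (hcs : cs = h.chartedSpace) (p : M) :
    (LinearMap.range (mfderiv 𝓘(ℂ, Fin n → ℂ) 𝓘(ℂ, V) ι p : (Fin n → ℂ) →L[ℂ] V).toLinearMap :
      Submodule ℂ V) = LinearMap.ker (fderiv ℂ f (ι p)).toLinearMap := by
  have hι := h.mdifferentiable hcs p
  have h1 : HasMFDerivAt 𝓘(ℂ, V) 𝓘(ℂ, W) f (ι p) (fderiv ℂ f (ι p)) :=
    (h.contDiff.differentiable (by simp) (ι p)).hasFDerivAt.hasMFDerivAt
  have h2 := h1.comp p hι.hasMFDerivAt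
  have h3 : f ∘ ι = fun _ => 0 := funext h.apply_eq_zero
  rw [h3] at h2
  have h4 := hasMFDerivAt_unique h2 (hasMFDerivAt_const (0 : W) p)
  have h6 := h.mfderiv_injective hcs p
  have h4' : ∀ u, fderiv ℂ f (ι p) (mfderiv 𝓘(ℂ, Fin n → ℂ) 𝓘(ℂ, V) ι p u) = 0 :=
    fun u => DFunLike.congr_fun h4 u
  generalize (mfderiv 𝓘(ℂ, Fin n → ℂ) 𝓘(ℂ, V) ι p : (Fin n → ℂ) →L[ℂ] V) = D at h4' h6
  have h5 : LinearMap.range D.toLinearMap ≤ LinearMap.ker (fderiv ℂ f (ι p)).toLinearMap := by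
    rintro _ ⟨u, rfl⟩
    exact h4' u
  refine Submodule.eq_of_le_of_finrank_eq h5 ?_
  have h7 := (fderiv ℂ f (ι p)).toLinearMap.finrank_range_add_finrank_ker
  rw [LinearMap.range_eq_top.2 (h.surjective_fderiv p), finrank_top, h.finrank_eq] at h7
  exact (LinearMap.finrank_range_of_inj (f := D.toLinearMap) h6).trans
    ((finrank_fin_fun ℂ).trans (Nat.add_left_cancel h7).symm)

/-- A constant bilinear form induces a holomorphic Riemannian metric on a regular level set if its
restrictions to the tangent spaces are nondegenerate. -/
theorem IsRegularLevelSet.isHolomorphicRiemannian [IsManifold 𝓘(ℂ, Fin n → ℂ) ω M]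
    (h : IsRegularLevelSet ι f n) (hcs : cs = h.chartedSpace) {b : LinearMap.BilinForm ℂ V}
    (hb : ∀ u v, b u v = b v u)
    (hn : ∀ p u, fderiv ℂ f (ι p) u = 0 → (∀ v, fderiv ℂ f (ι p) v = 0 → b u v = 0) → u = 0) :
    IsHolomorphicRiemannian ((constField b).pullback (I := 𝓘(ℂ, Fin n → ℂ)) ι) := by
  have hr := h.range_mfderiv hcs
  refine ⟨fun p u v => hb _ _, fun p u hu => ?_, fun U X Y _ hX hY => ?_⟩
  · apply h.mfderiv_injective hcs p
    rw [map_zero]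
    refine hn p _ ?_ fun v hv => ?_
    · exact (hr p).le ⟨u, rfl⟩
    · obtain ⟨w, rfl⟩ := (hr p).ge hv
      exact hu w
  · refine BilinField.contMDiffOn_pullback_constField b ?_ hX hY
    subst hcs
    exact h.contMDiff_val

end LevelSetMetrics

/-! ### Projections to quotients are local biholomorphisms -/

section QuotientCharts

variable {E M N : Type*} [NormedAddCommGroup E] [NormedSpace ℂ E]
  [TopologicalSpace M] [ChartedSpace E M] [TopologicalSpace N]

/-- The chart of `N` at `q` uses only one chosen preimage `s q`. There `π` and its local inverse are
identities in charts; at any other point of the fibre, holomorphy is transported by the maps `τ`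
that permute the fibre. -/
theorem isLocalDiffeomorph_of_isLocalHomeomorph [IsManifold 𝓘(ℂ, E) ω M] {π : M → N}
    (hπ : IsLocalHomeomorph π) (hs : Function.Surjective π)
    (hdeck : ∀ x y, π x = π y → ∃ τ : M → M, ContMDiff 𝓘(ℂ, E) 𝓘(ℂ, E) ω τ ∧ τ x = y ∧
      ∀ z, π (τ z) = π z) :
    letI : ChartedSpace E N := hπ.chartedSpace hs
    IsLocalDiffeomorph 𝓘(ℂ, E) 𝓘(ℂ, E) ω π := by
  let : ChartedSpace E N := hπ.chartedSpace hs
  have : IsManifold 𝓘(ℂ, E) ω N := isManifold_of_isLocalHomeomorph hπ hs hdeck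
  obtain ⟨s, hsr, hchart⟩ : ∃ s : N → M, (∀ q, π (s q) = q) ∧
      ∀ q, chartAt E q = (hπ.localInverseAt (s q)).trans (chartAt E (s q)) :=
    ⟨_, hs.hasRightInverse.choose_spec, fun _ => rfl⟩
  have hmem : ∀ q, q ∈ (hπ.localInverseAt (s q)).source := fun q => by
    have := hπ.apply_self_mem_localInverseAt_source (x := s q)
    rwa [hsr] at this
  have hval : ∀ q, hπ.localInverseAt (s q) q = s q := fun q => by
    have := hπ.localInverseAt_apply_self (x := s q)
    rwa [hsr] at this
  have h1 : ∀ q, ContMDiffAt 𝓘(ℂ, E) 𝓘(ℂ, E) ω π (s q) := by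
    intro q
    have ha : ContMDiffAt 𝓘(ℂ, E) 𝓘(ℂ, E) ω (chartAt E (s q)) (s q) :=
      contMDiffOn_chart.contMDiffAt (chart_source_mem_nhds E (s q))
    have hb : ContMDiffAt 𝓘(ℂ, E) 𝓘(ℂ, E) ω (chartAt E q).symm (chartAt E (s q) (s q)) := by
      refine (contMDiffOn_chart_symm (x := q)).contMDiffAt ?_
      have : chartAt E (s q) (s q) = chartAt E q q := by
        rw [hchart, OpenPartialHomeomorph.trans_apply, hval]
      rw [this]
      exact chart_target_mem_nhds E q
    refine (hb.comp _ ha).congr_of_eventuallyEq ?_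
    filter_upwards [chart_source_mem_nhds E (s q)] with x hx
    rw [hchart]
    simp only [mfld_simps, hπ.localInverseAt_symm]
    rw [(chartAt E (s q)).left_inv hx]
  have h2 : ∀ q, ContMDiffAt 𝓘(ℂ, E) 𝓘(ℂ, E) ω (hπ.localInverseAt (s q)) q := by
    intro q
    have ha : ContMDiffAt 𝓘(ℂ, E) 𝓘(ℂ, E) ω (chartAt E q) q :=
      contMDiffOn_chart.contMDiffAt (chart_source_mem_nhds E q)
    have hb : ContMDiffAt 𝓘(ℂ, E) 𝓘(ℂ, E) ω (chartAt E (s q)).symm (chartAt E q q) := by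
      refine (contMDiffOn_chart_symm (x := s q)).contMDiffAt ?_
      rw [hchart, OpenPartialHomeomorph.trans_apply, hval]
      exact chart_target_mem_nhds E (s q)
    refine (hb.comp _ ha).congr_of_eventuallyEq ?_
    filter_upwards [chart_source_mem_nhds E q] with x hx
    rw [hchart] at hx ⊢
    have hx' : hπ.localInverseAt (s q) x ∈ (chartAt E (s q)).source := by
      simp only [mfld_simps] at hx
      exact hx.2
    exact ((chartAt E (s q)).left_inv hx').symm
  have h3 : ContMDiff 𝓘(ℂ, E) 𝓘(ℂ, E) ω π := by
    intro x
    obtain ⟨τ, hτ, hτx, hτπ⟩ := hdeck x (s (π x)) (hsr _).symm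
    have h4 : ContMDiffAt 𝓘(ℂ, E) 𝓘(ℂ, E) ω (π ∘ τ) x :=
      ContMDiffAt.comp x (by rw [hτx]; exact h1 _) hτ.contMDiffAt
    rwa [show π ∘ τ = π from funext hτπ] at h4
  intro x
  have hsymm := hπ.localInverseAt_symm x
  refine ⟨⟨(hπ.localInverseAt x).symm.toPartialEquiv, (hπ.localInverseAt x).symm.open_source,
    (hπ.localInverseAt x).symm.open_target, ?_, ?_⟩, hπ.self_mem_localInverseAt_target, ?_⟩
  · change ContMDiffOn 𝓘(ℂ, E) 𝓘(ℂ, E) ω (hπ.localInverseAt x).symm _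
    rw [hsymm]
    exact h3.contMDiffOn
  · intro q hq
    have hq' : q ∈ (hπ.localInverseAt x).source := hq
    obtain ⟨σ, hσ, hσx, hσπ⟩ := hdeck (s q) (hπ.localInverseAt x q)
      ((hsr q).trans (hπ.apply_localInverseAt_of_mem hq').symm)
    have h4 : ContMDiffAt 𝓘(ℂ, E) 𝓘(ℂ, E) ω (σ ∘ hπ.localInverseAt (s q)) q :=
      ContMDiffAt.comp q hσ.contMDiffAt (h2 q)
    refine (h4.congr_of_eventuallyEq ?_).contMDiffWithinAt
    -- Moving the holomorphic section at `s q` by `σ` gives a section of `π`; once it lands in the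
    -- target of the local inverse at `x`, it must coincide with that inverse.
    have h5 : ∀ᶠ z in 𝓝 q, (σ ∘ hπ.localInverseAt (s q)) z ∈ (hπ.localInverseAt x).target := by
      refine h4.continuousAt.eventually_mem ((hπ.localInverseAt x).open_target.mem_nhds ?_)
      rw [Function.comp_apply, hval, hσx]
      exact (hπ.localInverseAt x).map_source hq'
    filter_upwards [h5, (hπ.localInverseAt (s q)).open_source.mem_nhds (hmem q)] with z hz hz'
    have h6 := (hπ.localInverseAt x).right_inv hz
    rw [hsymm, Function.comp_apply, hσπ, hπ.apply_localInverseAt_of_mem hz'] at h6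
    exact h6
  · intro y _
    exact (congrFun hsymm y).symm

end QuotientCharts

/-! ### The constant forms and the derivatives of the defining equations -/

section ConstantForms

/-- The polarization of `-det` on the ambient space `ℂ²ˣ²`. -/
def detForm : LinearMap.BilinForm ℂ Mat2Space :=
  LinearMap.mk₂ ℂ (fun U V => 1 / 2 * (U 0 1 * V 1 0 + U 1 0 * V 0 1 - U 0 0 * V 1 1 - U 1 1 * V 0 0))
    (fun U U' V => by simp only [Pi.add_apply]; ring)
    (fun c U V => by simp only [Pi.smul_apply, smul_eq_mul]; ring)
    (fun U V V' => by simp only [Pi.add_apply]; ring)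
    (fun c U V => by simp only [Pi.smul_apply, smul_eq_mul]; ring)

theorem detForm_apply (U V : Mat2Space) : detForm U V =
    1 / 2 * (U 0 1 * V 1 0 + U 1 0 * V 0 1 - U 0 0 * V 1 1 - U 1 1 * V 0 0) := rfl

theorem matForm_apply (M N : Mat2) :
    matForm M N = 1 / 2 * ((M * N).trace - M.trace * N.trace) := rfl

theorem matForm_eq_detForm (M N : Mat2) :
    matForm M N = detForm (fun i j => M i j) (fun i j => N i j) := by
  rw [matForm_apply, detForm_apply]
  simp only [Matrix.trace_fin_two, Matrix.mul_apply, Fin.sum_univ_two]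
  ring

theorem stdForm_apply (m : ℕ) (v w : Fin m → ℂ) : stdForm m v w = ∑ i, v i * w i := rfl

theorem detForm_comm (U V : Mat2Space) : detForm U V = detForm V U := by
  simp only [detForm_apply]
  ring

theorem stdForm_comm (m : ℕ) (v w : Fin m → ℂ) : stdForm m v w = stdForm m w v := by
  simp only [stdForm_apply, mul_comm]

theorem eq_zero_of_detForm {U : Mat2Space} (h : ∀ V, detForm U V = 0) : U = 0 := by
  have h1 := h ![![1, 0], ![0, 0]]
  have h2 := h ![![0, 1], ![0, 0]]
  have h3 := h ![![0, 0], ![1, 0]]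
  have h4 := h ![![0, 0], ![0, 1]]
  simp [detForm_apply] at h1 h2 h3 h4
  ext i j
  fin_cases i <;> fin_cases j <;> simpa

theorem eq_zero_of_stdForm {m : ℕ} {v : Fin m → ℂ} (h : ∀ w, stdForm m v w = 0) : v = 0 := by
  funext i
  simpa [stdForm_apply, Pi.single_apply] using h (Pi.single i 1)

/-- The map `X ↦ P X R` of the ambient space. -/
def mulCLM (P R : Mat2) : Mat2Space →L[ℂ] Mat2Space :=
  LinearMap.toContinuousLinearMap
    { toFun := fun X i j => (P * Matrix.of X * R) i j
      map_add' := fun X Y => by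
        funext i j
        rw [Matrix.of_add_of X Y |>.symm, mul_add, add_mul]
        rfl
      map_smul' := fun c X => by
        funext i j
        rw [← Matrix.smul_of, Matrix.mul_smul, Matrix.smul_mul]
        rfl }

theorem mulCLM_apply (P R : Mat2) (X : Mat2Space) :
    mulCLM P R X = fun i j => (P * Matrix.of X * R) i j := rfl

/-- This is multiplicativity of the determinant, polarized. It gives invariance both under left
translation and under conjugation. -/
theorem detForm_mulCLM (P R : Mat2) (X Y : Mat2Space) :
    detForm (mulCLM P R X) (mulCLM P R Y) = P.det * R.det * detForm X Y := by
  simp only [detForm_apply, mulCLM_apply, Matrix.det_fin_two, Matrix.mul_apply, Fin.sum_univ_two,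
    Matrix.of_apply]
  ring

/-- All the defining equations are quadratic polynomials along lines, so a derivative can be read
off as a linear coefficient. -/
theorem fderiv_apply_eq_of_quadratic {V W : Type*} [NormedAddCommGroup V] [NormedSpace ℂ V]
    [NormedAddCommGroup W] [NormedSpace ℂ W] {f : V → W} (hf : ContDiff ℂ ω f) {p v : V} {a b c : W}
    (h : ∀ t : ℂ, f (p + t • v) = a + t • b + t ^ 2 • c) : fderiv ℂ f p v = b := by
  apply fderiv_apply_eq_of_hasDerivAt hf
  rw [show (fun t : ℂ => f (p + t • v)) = fun t => a + t • b + t ^ 2 • c from funext h]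
  simpa using! (((hasDerivAt_id' (0 : ℂ)).smul_const b).const_add a).add
    (((hasDerivAt_id' (0 : ℂ)).fun_pow 2).smul_const c)

theorem fderiv_quadric (n : ℕ) (p v : Fin (n + 1) → ℂ) :
    fderiv ℂ (fun z : Fin (n + 1) → ℂ => ∑ i, z i ^ 2 + 1) p v = 2 * stdForm (n + 1) p v := by
  refine fderiv_apply_eq_of_quadratic (a := ∑ i, p i ^ 2 + 1) (c := ∑ i, v i ^ 2) (by fun_prop)
    fun t => ?_
  simp only [stdForm_apply, smul_eq_mul, Finset.mul_sum, Pi.add_apply, Pi.smul_apply]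
  rw [add_right_comm, add_right_comm (∑ i, p i ^ 2), add_right_comm _ (1 : ℂ),
    ← Finset.sum_add_distrib, ← Finset.sum_add_distrib]
  congr 1
  exact Finset.sum_congr rfl fun i _ => by ring

theorem fderiv_det2_sub (P v : Mat2Space) :
    fderiv ℂ (fun A => det2 A - 1) P v = -2 * detForm P v := by
  refine fderiv_apply_eq_of_quadratic (a := det2 P - 1) (c := det2 v) contDiff_det2_sub fun t => ?_
  simp only [det2, detForm_apply, smul_eq_mul, Pi.add_apply, Pi.smul_apply]
  ring

theorem fderiv_det2_tr2 (P v : Mat2Space) :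
    fderiv ℂ (fun A => (det2 A - 1, tr2 A)) P v = (-2 * detForm P v, tr2 v) := by
  refine fderiv_apply_eq_of_quadratic (a := (det2 P - 1, tr2 P)) (c := (det2 v, 0))
    (contDiff_det2_sub.prodMk contDiff_tr2) fun t => ?_
  simp only [det2, tr2, detForm_apply, smul_eq_mul, Pi.add_apply, Pi.smul_apply, Prod.smul_mk,
    Prod.mk_add_mk, Prod.mk.injEq]
  constructor <;> ring

theorem detForm_self (U : Mat2Space) : detForm U U = -det2 U := by
  rw [detForm_apply, det2]
  ring

/-- Hence being trace-free means being orthogonal to the identity matrix. -/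
theorem detForm_slMat_one (U : Mat2Space) : detForm (slMat 1) U = -(1 / 2) * tr2 U := by
  simp [detForm_apply, slMat, tr2]
  ring

end ConstantForms

/-! ### Nondegeneracy of the induced metrics -/

section QuadricMetrics

theorem isHolomorphicRiemannian_quadricMetric (n : ℕ) :
    IsHolomorphicRiemannian (quadricMetric n) := by
  refine (quadric_isRegularLevelSet n).isHolomorphicRiemannian rfl (stdForm_comm _) ?_
  intro p u hu h
  simp only [fderiv_quadric, mul_eq_zero, OfNat.ofNat_ne_zero, false_or] at hu h
  have hp : stdForm (n + 1) p.1 p.1 = -1 := by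
    rw [stdForm_apply]
    exact (Finset.sum_congr rfl fun i _ => (sq _).symm).trans p.2
  refine eq_zero_of_stdForm fun w => ?_
  -- Because `⟨p, p⟩ = -1`, this is the orthogonal projection of `w` to the tangent space at `p`;
  -- its correction term pairs to zero with the tangent vector `u`.
  have h1 := h (w + stdForm (n + 1) p.1 w • p.1) (by simp [hp])
  rwa [map_add, map_smul, stdForm_comm _ u p.1, hu, smul_zero, add_zero] at h1

theorem isHolomorphicRiemannian_pullback_slMat :
    IsHolomorphicRiemannian ((constField detForm).pullback (I := 𝓘(ℂ, Fin 3 → ℂ)) slMat) := by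
  refine sl_isRegularLevelSet.isHolomorphicRiemannian rfl detForm_comm ?_
  intro p u hu h
  simp only [fderiv_det2_sub, mul_eq_zero, neg_eq_zero, OfNat.ofNat_ne_zero, false_or] at hu h
  have hp : detForm (slMat p) (slMat p) = -1 := by rw [detForm_self, det2_slMat]
  refine eq_zero_of_detForm fun w => ?_
  have h1 := h (w + detForm (slMat p) w • slMat p) (by simp [hp])
  rwa [map_add, map_smul, detForm_comm u (slMat p), hu, smul_zero, add_zero] at h1

theorem isHolomorphicRiemannian_pullback_slsl :
    IsHolomorphicRiemannian ((constField detForm).pullback (I := 𝓘(ℂ, Fin 2 → ℂ))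
      (fun A : SLsl => slMat A.1)) := by
  refine slsl_isRegularLevelSet.isHolomorphicRiemannian rfl detForm_comm ?_
  intro p u hu h
  have h1 : tr2 (slMat p.1) = 0 := (tr2_slMat p.1).trans p.2
  have hp : detForm (slMat p.1) (slMat p.1) = -1 := by rw [detForm_self, det2_slMat]
  have htr : ∀ U, tr2 U = -2 * detForm (slMat 1) U := fun U => by
    rw [detForm_slMat_one]
    ring
  simp only [fderiv_det2_tr2] at hu h
  simp only [htr, Prod.mk_eq_zero, mul_eq_zero, neg_eq_zero,
    OfNat.ofNat_ne_zero, false_or] at hu h h1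
  have h11 : detForm (slMat 1) (slMat 1) = -1 := by rw [detForm_self, det2_slMat]
  refine eq_zero_of_detForm fun w => ?_
  -- The normal space is now spanned by `p` and the identity, which are orthogonal to each other and
  -- both of square `-1`, so the projection has two correction terms.
  have h2 := h (w + detForm (slMat p.1) w • slMat p.1 + detForm (slMat 1) w • slMat 1)
    (by simp [hp, h1, h11, detForm_comm (slMat p.1) (slMat 1)])
  rwa [map_add, map_add, map_smul, map_smul, detForm_comm u (slMat p.1), hu.1,
    detForm_comm u (slMat 1), hu.2, smul_zero, smul_zero, add_zero, add_zero] at h2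

end QuadricMetrics

/-! ### The Killing form of `𝔰𝔩₂` -/

section KillingForm

/-- The coordinates `(x₀₀, x₀₁, x₁₀)` of `𝔰𝔩₂`. -/
def slBasis : Basis (Fin 3) ℂ (LieAlgebra.SpecialLinear.sl (Fin 2) ℂ) :=
  Basis.ofEquivFun
    { toFun := fun X => ![X.1 0 0, X.1 0 1, X.1 1 0]
      map_add' := fun X Y => by ext i; fin_cases i <;> rfl
      map_smul' := fun c X => by ext i; fin_cases i <;> rfl
      invFun := fun x => ⟨!![x 0, x 1; x 2, -x 0], by
        change Matrix.trace (n := Fin 2) (R := ℂ) _ = 0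
        simp [Matrix.trace_fin_two]⟩
      left_inv := fun X => by
        have h : X.1 0 0 + X.1 1 1 = 0 := (Matrix.trace_fin_two _).symm.trans X.2
        ext i j
        fin_cases i <;> fin_cases j <;> simp
        linear_combination -h
      right_inv := fun x => by ext i; fin_cases i <;> rfl }

theorem slBasis_repr (X : LieAlgebra.SpecialLinear.sl (Fin 2) ℂ) (i : Fin 3) :
    slBasis.repr X i = ![X.1 0 0, X.1 0 1, X.1 1 0] i := rfl

theorem slBasis_val (i : Fin 3) : (slBasis i).1 =
    ![!![1, 0; 0, -1], !![0, 1; 0, 0], !![0, 0; 1, 0]] i := by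
  rw [slBasis, Basis.coe_ofEquivFun]
  fin_cases i <;> ext i j <;> fin_cases i <;> fin_cases j <;> simp

/-- The Killing form is `4 tr (X Y)`, and `detForm` is `tr (X Y) / 2` on trace-free matrices; this
explains the factor `1/8` in the metric. The trace of `ad X ∘ ad Y` is computed in the basis
`slBasis`. -/
theorem killingForm_sl_apply (X Y : LieAlgebra.SpecialLinear.sl (Fin 2) ℂ) :
    killingForm ℂ (LieAlgebra.SpecialLinear.sl (Fin 2) ℂ) X Y =
      8 * detForm (fun i j => X.1 i j) (fun i j => Y.1 i j) := by
  have hX : X.1 0 0 + X.1 1 1 = 0 := (Matrix.trace_fin_two _).symm.trans X.2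
  have hY : Y.1 0 0 + Y.1 1 1 = 0 := (Matrix.trace_fin_two _).symm.trans Y.2
  have h (i : Fin 3) : LinearMap.toMatrix slBasis slBasis
      (LieAlgebra.ad ℂ _ X ∘ₗ LieAlgebra.ad ℂ _ Y) i i = slBasis.repr ⁅X, ⁅Y, slBasis i⁆⁆ i :=
    LinearMap.toMatrix_apply _ _ _ _ _
  have hv (i : Fin 3) : (⁅X, ⁅Y, slBasis i⁆⁆ : LieAlgebra.SpecialLinear.sl (Fin 2) ℂ).1 =
      ⁅X.1, ⁅Y.1, (slBasis i).1⁆⁆ := rfl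
  rw [killingForm_apply_apply, LinearMap.trace_eq_matrix_trace ℂ slBasis, Matrix.trace]
  simp only [Matrix.diag_apply, h, Fin.sum_univ_three, slBasis_repr, hv, slBasis_val, Ring.lie_def,
    detForm_apply]
  rw [eq_neg_of_add_eq_zero_right hX, eq_neg_of_add_eq_zero_right hY]
  simp [Matrix.mul_apply, Fin.sum_univ_two, Matrix.vecMul, dotProduct]
  rw [eq_neg_of_add_eq_zero_right hX, eq_neg_of_add_eq_zero_right hY]
  ring

end KillingForm

/-! ### The metrics of `SL(2, ℂ)`, `PSL(2, ℂ)` and their trace-free parts -/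

section GroupMetrics

theorem slMat_mul (g A : SL(2, ℂ)) : slMat (g * A) = mulCLM g.1 1 (slMat A) := by
  funext i j
  rw [mulCLM_apply, mul_one]
  rfl

theorem contMDiff_slMat : ContMDiff 𝓘(ℂ, Fin 3 → ℂ) 𝓘(ℂ, Mat2Space) ω slMat :=
  sl_isRegularLevelSet.contMDiff_val

theorem contMDiff_mul_left_SL (g : SL(2, ℂ)) :
    ContMDiff 𝓘(ℂ, Fin 3 → ℂ) 𝓘(ℂ, Fin 3 → ℂ) ω (fun A : SL(2, ℂ) => g * A) := by
  apply sl_isRegularLevelSet.contMDiff_of_comp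
  simp only [slMat_mul]
  exact (mulCLM g.1 1).contDiff.contMDiff.comp contMDiff_slMat

theorem killingSL_apply (u v : TangentSpace 𝓘(ℂ, Fin 3 → ℂ) (1 : SL(2, ℂ))) :
    killingSL u v = detForm (slMatDeriv u) (slMatDeriv v) := by
  change (1 / 8 : ℂ) * killingForm ℂ (LieAlgebra.SpecialLinear.sl (Fin 2) ℂ)
    (tangentToSl u) (tangentToSl v) = _
  rw [killingForm_sl_apply, ← mul_assoc]
  norm_num
  rfl

/-- Left translation by `g⁻¹` lands at `g⁻¹ * g`, which is only propositionally the identity; the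
chain rule needs the derivative at that expression. -/
theorem hasMFDerivAt_at_inv_mul_self {G : Type*} [Group G] [TopologicalSpace G] {E : Type*}
    [NormedAddCommGroup E] [NormedSpace ℂ E] [ChartedSpace E G] {E' N : Type*}
    [NormedAddCommGroup E'] [NormedSpace ℂ E'] [TopologicalSpace N] [ChartedSpace E' N] {f : G → N}
    (hf : MDifferentiableAt 𝓘(ℂ, E) 𝓘(ℂ, E') f 1) (g : G) :
    HasMFDerivAt 𝓘(ℂ, E) 𝓘(ℂ, E') f (g⁻¹ * g)
      (mfderiv 𝓘(ℂ, E) 𝓘(ℂ, E') f 1 : E →L[ℂ] E') := by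
  have h : ∀ x : G, x = 1 →
      HasMFDerivAt 𝓘(ℂ, E) 𝓘(ℂ, E') f x (mfderiv 𝓘(ℂ, E) 𝓘(ℂ, E') f 1 : E →L[ℂ] E') := by
    rintro _ rfl
    exact hf.hasMFDerivAt
  exact h _ (inv_mul_cancel g)

theorem leftInvariant_apply {G E : Type*} [Group G] [TopologicalSpace G] [NormedAddCommGroup E]
    [NormedSpace ℂ E] [ChartedSpace E G]
    (b : LinearMap.BilinForm ℂ (TangentSpace 𝓘(ℂ, E) (1 : G))) (g : G)
    (u v : TangentSpace 𝓘(ℂ, E) g) {u' v' : TangentSpace 𝓘(ℂ, E) (1 : G)}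
    (hu : mfderiv 𝓘(ℂ, E) 𝓘(ℂ, E) (fun x => g⁻¹ * x) g u = (u' : E))
    (hv : mfderiv 𝓘(ℂ, E) 𝓘(ℂ, E) (fun x => g⁻¹ * x) g v = (v' : E)) :
    leftInvariant b g u v = b u' v' := by
  subst hu hv
  rfl

/-- Left translation is the restriction of a linear map of the matrix space, which is its own
derivative. -/
theorem slMatDeriv_translate (g : SL(2, ℂ)) (u : TangentSpace 𝓘(ℂ, Fin 3 → ℂ) g) :
    slMatDeriv (mfderiv 𝓘(ℂ, Fin 3 → ℂ) 𝓘(ℂ, Fin 3 → ℂ) (fun x => g⁻¹ * x) g u) =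
      mulCLM (g⁻¹).1 1 (mfderiv 𝓘(ℂ, Fin 3 → ℂ) 𝓘(ℂ, Mat2Space) slMat g u) := by
  have h1 := (contMDiff_mul_left_SL g⁻¹).mdifferentiable (by simp) g
  have h2 := contMDiff_slMat.mdifferentiable (by simp)
  have h3 := (hasMFDerivAt_at_inv_mul_self (h2 1) g).comp g h1.hasMFDerivAt
  have h4 := (mulCLM (g⁻¹).1 1).hasFDerivAt.hasMFDerivAt.comp g (h2 g).hasMFDerivAt
  have h5 : slMat ∘ (fun x => g⁻¹ * x) = mulCLM (g⁻¹).1 1 ∘ slMat := funext fun A => slMat_mul _ A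
  rw [h5] at h3
  exact DFunLike.congr_fun (hasMFDerivAt_unique h3 h4) u

/-- The two sides agree at the identity by the computation of the Killing form, and left
translations preserve `detForm` because the determinant is one. -/
theorem metricSL_eq_pullback : metricSL = (constField detForm).pullback slMat := by
  funext g
  ext u v
  refine (leftInvariant_apply killingSL g u v rfl rfl).trans ((killingSL_apply _ _).trans ?_)
  refine (congrArg₂ (fun a b => detForm a b) (slMatDeriv_translate g u)
    (slMatDeriv_translate g v)).trans ?_
  refine (detForm_mulCLM _ _ _ _).trans ?_
  rw [Matrix.SpecialLinearGroup.det_coe, Matrix.det_one, one_mul, one_mul]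
  rfl

theorem contMDiff_slsl_val :
    ContMDiff 𝓘(ℂ, Fin 2 → ℂ) 𝓘(ℂ, Fin 3 → ℂ) ω (Subtype.val : SLsl → SL(2, ℂ)) :=
  sl_isRegularLevelSet.contMDiff_of_comp slsl_isRegularLevelSet.contMDiff_val

theorem metricSLsl_eq_pullback :
    metricSLsl = (constField detForm).pullback (fun A : SLsl => slMat A.1) := by
  rw [metricSLsl, metricSL_eq_pullback]
  exact (BilinField.pullback_comp _ (contMDiff_slMat.mdifferentiable (by simp))
    (contMDiff_slsl_val.mdifferentiable (by simp))).symm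

theorem isHolomorphicRiemannian_metricSL : IsHolomorphicRiemannian metricSL :=
  metricSL_eq_pullback ▸ isHolomorphicRiemannian_pullback_slMat

theorem isHolomorphicRiemannian_metricSLsl : IsHolomorphicRiemannian metricSLsl :=
  metricSLsl_eq_pullback ▸ isHolomorphicRiemannian_pullback_slsl

theorem isLocalDiffeomorph_toPSL :
    IsLocalDiffeomorph 𝓘(ℂ, Fin 3 → ℂ) 𝓘(ℂ, Fin 3 → ℂ) ω toPSL := by
  refine isLocalDiffeomorph_of_isLocalHomeomorph toPSL_isCoveringMap.isLocalHomeomorph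
    toPSL_surjective ?_
  intro x y hxy
  rcases toPSL_eq_iff.1 hxy with rfl | rfl
  · exact ⟨id, contMDiff_id, rfl, fun _ => rfl⟩
  · exact ⟨fun A => -A, contMDiff_neg_SL, rfl, fun z => (toPSL_eq_iff.2 (Or.inr rfl)).symm⟩

/-- The involution `A ↦ -A` of `SL(2, ℂ) ∩ 𝔰𝔩₂`. -/
def negSLsl (A : SLsl) : SLsl := ⟨-A.1, by rw [trace_neg_SL, A.2, neg_zero]⟩

theorem contMDiff_negSLsl : ContMDiff 𝓘(ℂ, Fin 2 → ℂ) 𝓘(ℂ, Fin 2 → ℂ) ω negSLsl := by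
  apply slsl_isRegularLevelSet.contMDiff_of_comp
  exact (contDiff_neg (𝕜 := ℂ) (F := Mat2Space)).contMDiff.comp slsl_isRegularLevelSet.contMDiff_val

theorem toQ_eq_iff {A B : SLsl} : toQ A = toQ B ↔ B = A ∨ B = negSLsl A := by
  rw [Subtype.ext_iff, Subtype.ext_iff, Subtype.ext_iff]
  exact toPSL_eq_iff

theorem negSLsl_ne (A : SLsl) : negSLsl A ≠ A := by
  intro h
  have h1 : ∀ i j, -A.1.1 i j = A.1.1 i j := fun i j =>
    congrArg (fun B : SLsl => B.1.1 i j) h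
  have h2 := A.1.2
  rw [Matrix.det_fin_two, self_eq_neg.1 (h1 0 0).symm, self_eq_neg.1 (h1 0 1).symm] at h2
  simp at h2

theorem isLocalDiffeomorph_toQ :
    IsLocalDiffeomorph 𝓘(ℂ, Fin 2 → ℂ) 𝓘(ℂ, Fin 2 → ℂ) ω toQ := by
  refine isLocalDiffeomorph_of_isLocalHomeomorph toQ_isCoveringMap.isLocalHomeomorph
    toQ_surjective ?_
  intro x y hxy
  rcases toQ_eq_iff.1 hxy with rfl | rfl
  · exact ⟨id, contMDiff_id, rfl, fun _ => rfl⟩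
  · exact ⟨negSLsl, contMDiff_negSLsl, rfl, fun z => (toQ_eq_iff.2 (Or.inr rfl)).symm⟩

theorem preimage_toQ (A : SLsl) : toQ ⁻¹' {toQ A} = {A, negSLsl A} := by
  ext B
  rw [mem_preimage, mem_singleton_iff, eq_comm, toQ_eq_iff]
  rfl

theorem ncard_preimage_toQ (R : QSpace) : (toQ ⁻¹' {R}).ncard = 2 := by
  obtain ⟨A, rfl⟩ := toQ_surjective R
  rw [preimage_toQ, ncard_pair (negSLsl_ne A).symm]

/-- Along the local biholomorphism `toQ` the inclusion lifts to `SLsl → SL(2, ℂ) → PSL(2, ℂ)`, which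
is holomorphic. -/
theorem contMDiff_Q_val :
    ContMDiff 𝓘(ℂ, Fin 2 → ℂ) 𝓘(ℂ, Fin 3 → ℂ) ω (Subtype.val : QSpace → PSL(2, ℂ)) := by
  intro R
  obtain ⟨A, rfl⟩ := toQ_surjective R
  exact isLocalDiffeomorph_toQ.contMDiffAt_of_comp
    (isLocalDiffeomorph_toPSL.contMDiff.comp contMDiff_slsl_val).contMDiffAt

theorem metricPSL_apply (R : PSL(2, ℂ)) (u v : TangentSpace 𝓘(ℂ, Fin 3 → ℂ) R)
    {u' v' : TangentSpace 𝓘(ℂ, Fin 3 → ℂ) (1 : PSL(2, ℂ))}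
    (hu : mfderiv 𝓘(ℂ, Fin 3 → ℂ) 𝓘(ℂ, Fin 3 → ℂ) (fun x => R⁻¹ * x) R u = (u' : Fin 3 → ℂ))
    (hv : mfderiv 𝓘(ℂ, Fin 3 → ℂ) 𝓘(ℂ, Fin 3 → ℂ) (fun x => R⁻¹ * x) R v = (v' : Fin 3 → ℂ)) :
    metricPSL R u v = killingSL (tangentLift u') (tangentLift v') := by
  have h1 : metricPSL =
      leftInvariant (killingSL.compl₁₂ tangentLift.toLinearMap tangentLift.toLinearMap) := by
    rw [metricPSL]
  have h2 := leftInvariant_apply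
    (killingSL.compl₁₂ tangentLift.toLinearMap tangentLift.toLinearMap) R u v hu hv
  rw [h1]
  exact h2.trans (LinearMap.compl₁₂_apply _ _ _ _ _)

theorem tangentLift_mfderiv_toPSL (u : TangentSpace 𝓘(ℂ, Fin 3 → ℂ) (1 : SL(2, ℂ))) :
    tangentLift (mfderiv 𝓘(ℂ, Fin 3 → ℂ) 𝓘(ℂ, Fin 3 → ℂ) toPSL 1 u) = u :=
  (isLocalDiffeomorph_toPSL.isInvertible_mfderiv 1).inverse_apply_self u

/-- The projection is a homomorphism, so it intertwines left translations; differentiate that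
identity at `g`. -/
theorem mfderiv_toPSL_translate (g : SL(2, ℂ)) (u : TangentSpace 𝓘(ℂ, Fin 3 → ℂ) g) :
    mfderiv 𝓘(ℂ, Fin 3 → ℂ) 𝓘(ℂ, Fin 3 → ℂ) (fun x => (toPSL g)⁻¹ * x) (toPSL g)
        (mfderiv 𝓘(ℂ, Fin 3 → ℂ) 𝓘(ℂ, Fin 3 → ℂ) toPSL g u) =
      (mfderiv 𝓘(ℂ, Fin 3 → ℂ) 𝓘(ℂ, Fin 3 → ℂ) toPSL 1 : (Fin 3 → ℂ) →L[ℂ] (Fin 3 → ℂ))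
        (mfderiv 𝓘(ℂ, Fin 3 → ℂ) 𝓘(ℂ, Fin 3 → ℂ) (fun x => g⁻¹ * x) g u) := by
  have hd := isLocalDiffeomorph_toPSL.mdifferentiable (by simp)
  have h0 : (fun x => (toPSL g)⁻¹ * x) ∘ toPSL = toPSL ∘ fun x => g⁻¹ * x := funext fun _ => rfl
  have h1 := (contMDiff_mul_left_SL g⁻¹).mdifferentiable (by simp) g
  have h2 : MDifferentiableAt 𝓘(ℂ, Fin 3 → ℂ) 𝓘(ℂ, Fin 3 → ℂ) (fun x => (toPSL g)⁻¹ * x)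
      (toPSL g) := by
    refine (isLocalDiffeomorph_toPSL.contMDiffAt_of_comp ?_).mdifferentiableAt (n := ω) (by simp)
    rw [h0]
    exact (isLocalDiffeomorph_toPSL.contMDiff.comp (contMDiff_mul_left_SL g⁻¹)).contMDiffAt
  have h3 := h2.hasMFDerivAt.comp g (hd g).hasMFDerivAt
  have h4 := (hasMFDerivAt_at_inv_mul_self (hd 1) g).comp g h1.hasMFDerivAt
  rw [h0] at h3
  exact DFunLike.congr_fun (hasMFDerivAt_unique h3 h4) u

theorem pullback_metricPSL : metricPSL.pullback toPSL = metricSL := by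
  funext g
  ext u v
  rw [BilinField.pullback_apply]
  refine (metricPSL_apply _ _ _ (mfderiv_toPSL_translate g u)
    (mfderiv_toPSL_translate g v)).trans ?_
  refine Eq.trans ?_ (leftInvariant_apply killingSL g u v rfl rfl).symm
  exact congrArg₂ (fun a b => killingSL a b) (tangentLift_mfderiv_toPSL _)
    (tangentLift_mfderiv_toPSL _)

theorem isHolomorphicRiemannian_metricPSL : IsHolomorphicRiemannian metricPSL :=
  isHolomorphicRiemannian_metricSL.of_pullback isLocalDiffeomorph_toPSL toPSL_surjective
    pullback_metricPSL

/-- Both sides are the pullback of `metricPSL` by the diagonal of the commutative square formed by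
the two inclusions and the two projections. -/
theorem pullback_metricQ : metricQ.pullback toQ = metricSLsl := by
  rw [metricQ, metricSLsl, ← pullback_metricPSL,
    ← BilinField.pullback_comp _ (contMDiff_Q_val.mdifferentiable (by simp))
      (isLocalDiffeomorph_toQ.mdifferentiable (by simp)),
    ← BilinField.pullback_comp _ (isLocalDiffeomorph_toPSL.mdifferentiable (by simp))
      (contMDiff_slsl_val.mdifferentiable (by simp))]
  rfl

theorem isHolomorphicRiemannian_metricQ : IsHolomorphicRiemannian metricQ :=
  isHolomorphicRiemannian_metricSLsl.of_pullback isLocalDiffeomorph_toQ toQ_surjective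
    pullback_metricQ

end GroupMetrics

/-! ### The linear isometry `F` and its restrictions -/

section MapF

theorem BilinField.pullback_constField {V W : Type*} [NormedAddCommGroup V] [NormedSpace ℂ V]
    [NormedAddCommGroup W] [NormedSpace ℂ W] {b : LinearMap.BilinForm ℂ V}
    {b' : LinearMap.BilinForm ℂ W} {L : W →L[ℂ] V} (h : ∀ u v, b (L u) (L v) = b' u v) :
    (constField b).pullback (I := 𝓘(ℂ, W)) L = constField b' := by
  funext p
  ext u v
  rw [pullback_apply, mfderiv_eq_fderiv, L.fderiv]
  exact h u v

/-- The map `F` into the ambient space. -/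
def mapFCLM : (Fin 4 → ℂ) →L[ℂ] Mat2Space :=
  LinearMap.toContinuousLinearMap
    { toFun := fun z i j => mapF z i j
      map_add' := fun z w => by rw [map_add]; rfl
      map_smul' := fun c z => by rw [map_smul]; rfl }

theorem mapFCLM_apply (z : Fin 4 → ℂ) : mapFCLM z = fun i j => mapF z i j := rfl

/-- The inverse of `F`. -/
def mapFInv : Mat2Space →L[ℂ] (Fin 4 → ℂ) :=
  LinearMap.toContinuousLinearMap
    { toFun := fun M => ![(M 1 1 - M 0 0) / 2, -(M 0 1 + M 1 0) / 2,
        Complex.I * (M 0 1 - M 1 0) / 2, Complex.I * (M 0 0 + M 1 1) / 2]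
      map_add' := fun M N => by ext i; fin_cases i <;> simp <;> ring
      map_smul' := fun c M => by ext i; fin_cases i <;> simp <;> ring }

theorem mapFInv_apply (M : Mat2Space) : mapFInv M = ![(M 1 1 - M 0 0) / 2, -(M 0 1 + M 1 0) / 2,
    Complex.I * (M 0 1 - M 1 0) / 2, Complex.I * (M 0 0 + M 1 1) / 2] := rfl

theorem mapF_apply (z : Fin 4 → ℂ) :
    mapF z = !![-z 0 - Complex.I * z 3, -z 1 - Complex.I * z 2;
      -z 1 + Complex.I * z 2, z 0 - Complex.I * z 3] := rfl

theorem mapFInv_mapFCLM (z : Fin 4 → ℂ) : mapFInv (mapFCLM z) = z := by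
  rw [mapFInv_apply, mapFCLM_apply, mapF_apply]
  ext i
  fin_cases i <;> simp <;> ring_nf <;> simp

theorem mapFCLM_mapFInv (M : Mat2Space) : mapFCLM (mapFInv M) = M := by
  rw [mapFInv_apply, mapFCLM_apply, mapF_apply]
  ext i j
  fin_cases i <;> fin_cases j <;> simp <;> ring_nf <;> simp <;> ring

theorem bijective_mapF : Function.Bijective mapF :=
  Function.bijective_iff_has_inverse.2 ⟨mapFInv, mapFInv_mapFCLM, mapFCLM_mapFInv⟩

theorem detForm_mapFCLM (z w : Fin 4 → ℂ) :
    detForm (mapFCLM z) (mapFCLM w) = stdForm 4 z w := by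
  rw [detForm_apply, stdForm_apply, mapFCLM_apply, mapFCLM_apply, mapF_apply, mapF_apply,
    Fin.sum_univ_four]
  simp
  linear_combination (-z 2 * w 2 - z 3 * w 3) * Complex.I_mul_I

theorem matForm_mapF (z w : Fin 4 → ℂ) : matForm (mapF z) (mapF w) = stdForm 4 z w :=
  (matForm_eq_detForm _ _).trans (detForm_mapFCLM z w)

theorem matForm_self (M : Mat2) : matForm M M = -M.det := by
  rw [matForm_eq_detForm, detForm_self, Matrix.det_fin_two]
  rfl

theorem det_mapF (z : Fin 4 → ℂ) : (mapF z).det = -∑ i, z i ^ 2 := by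
  rw [← neg_eq_iff_eq_neg, ← matForm_self, matForm_mapF, stdForm_apply]
  exact Finset.sum_congr rfl fun i _ => (sq _).symm

theorem trace_mapF (z : Fin 4 → ℂ) : (mapF z).trace = -2 * Complex.I * z 3 := by
  rw [mapF_apply, Matrix.trace_fin_two]
  simp
  ring

/-- Under the bijection `F`, the determinant is minus the sum of squares and the trace is a nonzero
multiple of the last coordinate. -/
theorem image_mapF : mapF '' {z | z 3 = 0 ∧ ∑ i, z i ^ 2 = -1} = {M | M.det = 1 ∧ M.trace = 0} := by
  ext M
  obtain ⟨z, rfl⟩ := bijective_mapF.2 M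
  rw [bijective_mapF.1.mem_set_image, mem_ofPred_eq, mem_ofPred_eq, det_mapF, trace_mapF,
    neg_eq_iff_eq_neg, and_comm]
  simp

/-- The isometry `𝕏₃ → SL(2, ℂ)` given by `F`. -/
def quadricThreeDiffeo :
    Diffeomorph 𝓘(ℂ, Fin 3 → ℂ) 𝓘(ℂ, Fin 3 → ℂ) (Quadric 3) SL(2, ℂ) ω where
  toFun z := ⟨mapF z.1, by rw [det_mapF, z.2, neg_neg]⟩
  invFun A := ⟨mapFInv (slMat A), by
    rw [← neg_neg (∑ i, _), ← det_mapF]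
    exact congrArg Neg.neg ((congrArg (fun X => Matrix.det (Matrix.of X))
      (mapFCLM_mapFInv (slMat A))).trans A.2)⟩
  left_inv z := Subtype.ext (mapFInv_mapFCLM z.1)
  right_inv A := Subtype.ext (mapFCLM_mapFInv (slMat A))
  contMDiff_toFun := sl_isRegularLevelSet.contMDiff_of_comp
    (mapFCLM.contDiff.contMDiff.comp (quadric_isRegularLevelSet 3).contMDiff_val)
  contMDiff_invFun := (quadric_isRegularLevelSet 3).contMDiff_of_comp
    (mapFInv.contDiff.contMDiff.comp contMDiff_slMat)

theorem isIsometry_quadricThreeDiffeo :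
    IsIsometry (quadricMetric 3) metricSL quadricThreeDiffeo := by
  rw [IsIsometry, metricSL_eq_pullback, ← BilinField.pullback_comp _
    (contMDiff_slMat.mdifferentiable (by simp)) (quadricThreeDiffeo.contMDiff.mdifferentiable
    (by simp)), quadricMetric, ← BilinField.pullback_constField (L := mapFCLM) detForm_mapFCLM,
    ← BilinField.pullback_comp _ (mapFCLM.contDiff.contMDiff.mdifferentiable (n := ω) (by simp))
    ((quadric_isRegularLevelSet 3).mdifferentiable rfl)]
  rfl

/-- The inclusion of the hyperplane `z₃ = 0`. -/
def hyperplaneIncl : (Fin 3 → ℂ) →L[ℂ] (Fin 4 → ℂ) :=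
  LinearMap.toContinuousLinearMap
    { toFun := fun z => ![z 0, z 1, z 2, 0]
      map_add' := fun z w => by ext i; fin_cases i <;> simp
      map_smul' := fun c z => by ext i; fin_cases i <;> simp }

theorem hyperplaneIncl_apply (z : Fin 3 → ℂ) : hyperplaneIncl z = ![z 0, z 1, z 2, 0] := rfl

theorem stdForm_hyperplaneIncl (z w : Fin 3 → ℂ) :
    stdForm 4 (hyperplaneIncl z) (hyperplaneIncl w) = stdForm 3 z w := by
  simp [stdForm_apply, Fin.sum_univ_four, Fin.sum_univ_three, hyperplaneIncl_apply]

/-- The projection to the hyperplane `z₃ = 0`. -/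
def hyperplaneProj : (Fin 4 → ℂ) →L[ℂ] (Fin 3 → ℂ) :=
  LinearMap.toContinuousLinearMap
    { toFun := fun z => ![z 0, z 1, z 2]
      map_add' := fun z w => by ext i; fin_cases i <;> simp
      map_smul' := fun c z => by ext i; fin_cases i <;> simp }

theorem hyperplaneProj_apply (z : Fin 4 → ℂ) : hyperplaneProj z = ![z 0, z 1, z 2] := rfl

theorem hyperplaneIncl_hyperplaneProj {z : Fin 4 → ℂ} (hz : z 3 = 0) :
    hyperplaneIncl (hyperplaneProj z) = z := by
  ext i
  fin_cases i <;> simp [hyperplaneIncl_apply, hyperplaneProj_apply, hz]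

theorem mapFInv_slMat_three (A : SLsl) : mapFInv (slMat A.1) 3 = 0 := by
  have h : tr2 (slMat A.1) = 0 := (tr2_slMat A.1).trans A.2
  rw [tr2] at h
  simp [mapFInv_apply, h]

/-- The isometry `𝕏₂ → SL(2, ℂ) ∩ 𝔰𝔩₂` given by `F`. -/
def quadricTwoDiffeo :
    Diffeomorph 𝓘(ℂ, Fin 2 → ℂ) 𝓘(ℂ, Fin 2 → ℂ) (Quadric 2) SLsl ω where
  toFun z := ⟨⟨mapF (hyperplaneIncl z.1), by
      have h := z.2
      rw [det_mapF, neg_eq_iff_eq_neg]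
      simpa [hyperplaneIncl_apply, Fin.sum_univ_four, Fin.sum_univ_three] using h⟩, by
    change (mapF (hyperplaneIncl z.1)).trace = 0
    rw [trace_mapF]
    simp [hyperplaneIncl_apply]⟩
  invFun A := ⟨hyperplaneProj (mapFInv (slMat A.1)), by
    have h := (quadricThreeDiffeo.symm A.1).2
    change ∑ i, mapFInv (slMat A.1) i ^ 2 = -1 at h
    rw [Fin.sum_univ_four, mapFInv_slMat_three] at h
    simpa [hyperplaneProj_apply, Fin.sum_univ_three] using h⟩
  left_inv z := Subtype.ext (by
    change hyperplaneProj (mapFInv (mapFCLM (hyperplaneIncl z.1))) = z.1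
    rw [mapFInv_mapFCLM]
    ext i
    fin_cases i <;> rfl)
  right_inv A := Subtype.ext (Subtype.ext (by
    change mapFCLM (hyperplaneIncl (hyperplaneProj (mapFInv (slMat A.1)))) = slMat A.1
    rw [hyperplaneIncl_hyperplaneProj (mapFInv_slMat_three A), mapFCLM_mapFInv]))
  contMDiff_toFun := slsl_isRegularLevelSet.contMDiff_of_comp
    ((mapFCLM.comp hyperplaneIncl).contDiff.contMDiff.comp
      (quadric_isRegularLevelSet 2).contMDiff_val)
  contMDiff_invFun := (quadric_isRegularLevelSet 2).contMDiff_of_comp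
    ((hyperplaneProj.comp mapFInv).contDiff.contMDiff.comp slsl_isRegularLevelSet.contMDiff_val)

theorem isIsometry_quadricTwoDiffeo :
    IsIsometry (quadricMetric 2) metricSLsl quadricTwoDiffeo := by
  rw [IsIsometry, metricSLsl_eq_pullback, ← BilinField.pullback_comp _
    (slsl_isRegularLevelSet.mdifferentiable rfl) (quadricTwoDiffeo.contMDiff.mdifferentiable
    (by simp)), quadricMetric, ← BilinField.pullback_constField (L := mapFCLM.comp hyperplaneIncl)
      fun u v => (detForm_mapFCLM _ _).trans (stdForm_hyperplaneIncl u v),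
    ← BilinField.pullback_comp _
      ((mapFCLM.comp hyperplaneIncl).contDiff.contMDiff.mdifferentiable (n := ω) (by simp))
      ((quadric_isRegularLevelSet 2).mdifferentiable rfl)]
  rfl

end MapF

/-! ### Homogeneous and affine coordinates on the Riemann sphere -/

section SphereMaps

variable {E H P : Type*} [NormedAddCommGroup E] [NormedSpace ℂ E] [TopologicalSpace H]
  {J : ModelWithCorners ℂ E H} [TopologicalSpace P] [ChartedSpace H P]

theorem contMDiff_sphere_coe : ContMDiff 𝓘(ℂ) 𝓘(ℂ) ω ((↑) : ℂ → OnePoint ℂ) := fun z =>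
  (contMDiffOn_chart_symm (I := 𝓘(ℂ)) (x := ((z : ℂ) : OnePoint ℂ))).contMDiffAt
    (sphereChartZero.open_target.mem_nhds (by simp [sphereChartZero]))

theorem contMDiff_sphereInv_coe :
    ContMDiff 𝓘(ℂ) 𝓘(ℂ) ω (fun z : ℂ => sphereInv (z : OnePoint ℂ)) := fun z =>
  (contMDiffOn_chart_symm (I := 𝓘(ℂ)) (x := (OnePoint.infty : OnePoint ℂ))).contMDiffAt
    (sphereChartInfty.open_target.mem_nhds
      (by simp [sphereChartInfty, sphereChartZero, sphereInvHomeo]))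

theorem contMDiffAt_sphere_coe_of_comp {h : OnePoint ℂ → P} {z : ℂ}
    (hh : ContMDiffAt 𝓘(ℂ) J ω (fun w : ℂ => h w) z) :
    ContMDiffAt 𝓘(ℂ) J ω h (z : OnePoint ℂ) := by
  have h1 : ContMDiffAt 𝓘(ℂ) 𝓘(ℂ) ω sphereChartZero (z : OnePoint ℂ) :=
    (contMDiffOn_chart (I := 𝓘(ℂ)) (x := (z : OnePoint ℂ))).contMDiffAt
      (chart_source_mem_nhds ℂ (z : OnePoint ℂ))
  rw [← sphereChartZero_coe z] at hh
  refine (hh.comp _ h1).congr_of_eventuallyEq ?_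
  filter_upwards [chart_source_mem_nhds ℂ (z : OnePoint ℂ)] with x hx
  exact congrArg h (sphereChartZero.left_inv hx).symm

theorem contMDiffAt_sphere_infty_of_comp {h : OnePoint ℂ → P}
    (hh : ContMDiffAt 𝓘(ℂ) J ω (fun w : ℂ => h (sphereInv w)) 0) :
    ContMDiffAt 𝓘(ℂ) J ω h OnePoint.infty := by
  have h1 : ContMDiffAt 𝓘(ℂ) 𝓘(ℂ) ω sphereChartInfty (OnePoint.infty : OnePoint ℂ) :=
    (contMDiffOn_chart (I := 𝓘(ℂ)) (x := (OnePoint.infty : OnePoint ℂ))).contMDiffAt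
      (chart_source_mem_nhds ℂ (OnePoint.infty : OnePoint ℂ))
  have h2 : sphereChartInfty OnePoint.infty = 0 := by
    rw [sphereChartInfty_apply, sphereInv_infty, sphereChartZero_coe]
  rw [← h2] at hh
  refine (hh.comp _ h1).congr_of_eventuallyEq ?_
  filter_upwards [chart_source_mem_nhds ℂ (OnePoint.infty : OnePoint ℂ)] with x hx
  exact congrArg h (sphereChartInfty.left_inv hx).symm

theorem boundaryVector_coe (z : ℂ) : boundaryVector z = ![z, 1] := rfl

theorem boundaryVector_infty : boundaryVector OnePoint.infty = ![1, 0] := rfl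

theorem boundaryVector_ne_zero (x : OnePoint ℂ) : boundaryVector x ≠ 0 := by
  intro h
  induction x using OnePoint.rec with
  | infty => simpa [boundaryVector_infty] using congrFun h 0
  | coe z => simpa [boundaryVector_coe] using congrFun h 1

/-- The second coordinate of the image of the spanning vector of `x` under `A`. -/
def moebiusDenom (A : SL(2, ℂ)) (x : OnePoint ℂ) : ℂ := (A.1.mulVec (boundaryVector x)) 1

theorem moebius_coe (A : SL(2, ℂ)) (z : ℂ) : moebius A z =
    if A.1 1 0 * z + A.1 1 1 = 0 then OnePoint.infty
    else (((A.1 0 0 * z + A.1 0 1) / (A.1 1 0 * z + A.1 1 1) : ℂ) : OnePoint ℂ) :=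
  OnePoint.smul_some_eq_ite

theorem moebius_infty (A : SL(2, ℂ)) : moebius A OnePoint.infty =
    if A.1 1 0 = 0 then OnePoint.infty else ((A.1 0 0 / A.1 1 0 : ℂ) : OnePoint ℂ) :=
  OnePoint.smul_infty_eq_ite _

/-- The formula also holds at the pole, where the default value `0` of `affineCoord` agrees with
division by zero. -/
theorem affineCoord_coe (A : SL(2, ℂ)) (z : ℂ) :
    affineCoord A z = (A.1 0 0 * z + A.1 0 1) / (A.1 1 0 * z + A.1 1 1) := by
  rw [affineCoord, moebius_coe]
  split_ifs with h
  · rw [h, div_zero]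
    rfl
  · rfl

theorem affineCoord_infty (A : SL(2, ℂ)) :
    affineCoord A OnePoint.infty = A.1 0 0 / A.1 1 0 := by
  rw [affineCoord, moebius_infty]
  split_ifs with h
  · rw [h, div_zero]
    rfl
  · rfl

theorem moebiusDenom_coe (A : SL(2, ℂ)) (z : ℂ) :
    moebiusDenom A z = A.1 1 0 * z + A.1 1 1 := by
  simp [moebiusDenom, boundaryVector_coe, Matrix.mulVec, dotProduct, Fin.sum_univ_two]

theorem moebiusDenom_infty (A : SL(2, ℂ)) : moebiusDenom A OnePoint.infty = A.1 1 0 := by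
  simp [moebiusDenom, boundaryVector_infty, Matrix.mulVec, dotProduct, Fin.sum_univ_two]

theorem moebius_ne_infty_iff {A : SL(2, ℂ)} {x : OnePoint ℂ} :
    moebius A x ≠ OnePoint.infty ↔ moebiusDenom A x ≠ 0 := by
  induction x using OnePoint.rec with
  | infty => rw [moebius_infty, moebiusDenom_infty]; split_ifs with h <;> simp [h]
  | coe z => rw [moebius_coe, moebiusDenom_coe]; split_ifs with h <;> simp [h]

theorem mulVec_boundaryVector {A : SL(2, ℂ)} {x : OnePoint ℂ} (h : moebius A x ≠ OnePoint.infty) :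
    A.1.mulVec (boundaryVector x) = moebiusDenom A x • ![affineCoord A x, 1] := by
  rw [moebius_ne_infty_iff] at h
  ext i
  fin_cases i
  · induction x using OnePoint.rec with
    | infty =>
      rw [moebiusDenom_infty] at h ⊢
      simp [affineCoord_infty, boundaryVector_infty, Matrix.mulVec, dotProduct, Fin.sum_univ_two]
      field_simp
    | coe z =>
      rw [moebiusDenom_coe] at h ⊢
      simp [affineCoord_coe, boundaryVector_coe, Matrix.mulVec, dotProduct, Fin.sum_univ_two]
      rw [mul_div_cancel₀ _ h]
  · simp [moebiusDenom]

theorem contMDiffAt_affineCoord {A : SL(2, ℂ)} {x : OnePoint ℂ}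
    (h : moebius A x ≠ OnePoint.infty) : ContMDiffAt 𝓘(ℂ) 𝓘(ℂ) ω (affineCoord A) x := by
  rw [moebius_ne_infty_iff] at h
  induction x using OnePoint.rec with
  | infty =>
    rw [moebiusDenom_infty] at h
    apply contMDiffAt_sphere_infty_of_comp
    have h1 : ContDiffAt ℂ ω (fun w : ℂ => (A.1 0 0 + A.1 0 1 * w) / (A.1 1 0 + A.1 1 1 * w)) 0 :=
      ContDiffAt.div (by fun_prop) (by fun_prop) (by simpa using h)
    refine h1.contMDiffAt.congr_of_eventuallyEq (.of_forall fun w => ?_)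
    by_cases hw : w = 0
    · simp [hw, sphereInv_zero, affineCoord_infty]
    · simp only [sphereInv_coe hw, affineCoord_coe]
      -- In the coordinate `w = 1 / z` the Möbius fraction is expanded by `w`, which gives the form
      -- that is regular at `w = 0`.
      rw [← mul_div_mul_right _ _ hw, add_mul, add_mul, inv_mul_cancel_right₀ hw,
        inv_mul_cancel_right₀ hw]
  | coe z =>
    rw [moebiusDenom_coe] at h
    apply contMDiffAt_sphere_coe_of_comp
    simp only [affineCoord_coe]
    have h1 : ContDiffAt ℂ ω
        (fun w : ℂ => (A.1 0 0 * w + A.1 0 1) / (A.1 1 0 * w + A.1 1 1)) z :=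
      ContDiffAt.div (by fun_prop) (by fun_prop) h
    exact h1.contMDiffAt

/-- Only the single point `A⁻¹ ∞` is excluded, and points are closed. -/
theorem eventually_moebius_ne_infty {A : SL(2, ℂ)} {x : OnePoint ℂ}
    (h : moebius A x ≠ OnePoint.infty) : ∀ᶠ y in 𝓝 x, moebius A y ≠ OnePoint.infty := by
  have h1 : ∀ y, moebius A y ≠ OnePoint.infty ↔
      y ≠ (Matrix.SpecialLinearGroup.toGL A)⁻¹ • OnePoint.infty := fun y =>
    not_congr (smul_eq_iff_eq_inv_smul _)
  simp only [h1] at h ⊢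
  exact isOpen_ne.mem_nhds h

/-- The point of the sphere corresponding to the line spanned by a nonzero vector. -/
def lineOf (v : Fin 2 → ℂ) : OnePoint ℂ :=
  if v 1 = 0 then OnePoint.infty else ((v 0 / v 1 : ℂ) : OnePoint ℂ)

theorem lineOf_boundaryVector (x : OnePoint ℂ) : lineOf (boundaryVector x) = x := by
  induction x using OnePoint.rec with
  | infty => simp [lineOf, boundaryVector_infty]
  | coe z => simp [lineOf, boundaryVector_coe]

theorem lineOf_eq_of_det_eq_zero {v w : Fin 2 → ℂ} (hv : v ≠ 0) (hw : w ≠ 0)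
    (h : v 0 * w 1 = v 1 * w 0) : lineOf v = lineOf w := by
  have hne : ∀ {u : Fin 2 → ℂ}, u ≠ 0 → u 1 = 0 → u 0 ≠ 0 := fun hu h1 h0 => hu (by
    ext i
    fin_cases i
    exacts [h0, h1])
  by_cases hv1 : v 1 = 0
  · have hw1 : w 1 = 0 := by simpa [hv1, hne hv hv1] using h
    simp [lineOf, hv1, hw1]
  · by_cases hw1 : w 1 = 0
    · exact absurd (by simpa [hw1, hv1] using h.symm) (hne hw hw1)
    · simp only [lineOf, hv1, hw1, if_false]
      congr 1
      rw [div_eq_div_iff hv1 hw1, h, mul_comm]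

theorem exists_smul_boundaryVector_lineOf {v : Fin 2 → ℂ} (hv : v ≠ 0) :
    ∃ c : ℂ, c ≠ 0 ∧ v = c • boundaryVector (lineOf v) := by
  by_cases h : v 1 = 0
  · refine ⟨v 0, fun h0 => hv ?_, ?_⟩
    · ext i
      fin_cases i
      exacts [h0, h]
    · rw [lineOf, if_pos h, boundaryVector_infty]
      ext i
      fin_cases i <;> simp [h]
  · refine ⟨v 1, h, ?_⟩
    rw [lineOf, if_neg h, boundaryVector_coe]
    ext i
    fin_cases i
    · simp [mul_div_cancel₀ _ h]
    · simp

theorem contMDiffAt_lineOf {v : Fin 2 → ℂ} (hv : v ≠ 0) :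
    ContMDiffAt 𝓘(ℂ, Fin 2 → ℂ) 𝓘(ℂ) ω lineOf v := by
  by_cases h : v 1 = 0
  · have h0 : v 0 ≠ 0 := fun h0 => hv (by
      ext i
      fin_cases i
      exacts [h0, h])
    have h1 : ContDiffAt ℂ ω (fun v : Fin 2 → ℂ => v 1 / v 0) v :=
      ContDiffAt.div (by fun_prop) (by fun_prop) h0
    -- Near a vector representing `∞`, the line is described by the coordinate `1 / z = v₁ / v₀`.
    refine (contMDiff_sphereInv_coe.contMDiffAt.comp v h1.contMDiffAt).congr_of_eventuallyEq ?_
    filter_upwards [(continuous_apply (0 : Fin 2)).continuousAt.eventually_ne h0] with w hw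
    by_cases hw1 : w 1 = 0
    · simp [lineOf, hw1, sphereInv_zero]
    · rw [lineOf, if_neg hw1, Function.comp_apply, sphereInv_coe (div_ne_zero hw1 hw), inv_div]
  · have h1 : ContDiffAt ℂ ω (fun v : Fin 2 → ℂ => v 0 / v 1) v :=
      ContDiffAt.div (by fun_prop) (by fun_prop) h
    refine (contMDiff_sphere_coe.contMDiffAt.comp v h1.contMDiffAt).congr_of_eventuallyEq ?_
    filter_upwards [(continuous_apply (1 : Fin 2)).continuousAt.eventually_ne h] with w hw
    exact if_neg hw

end SphereMaps

/-! ### The matrix with prescribed eigenlines for `±i` -/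

section RotationMatrix

/-- The determinant of the matrix with columns `v` and `w`. -/
def crossDet (v w : Fin 2 → ℂ) : ℂ := v 0 * w 1 - v 1 * w 0

/-- The matrix with eigenvectors `v` and `w` for the eigenvalues `i` and `-i`. -/
def rotMat (v w : Fin 2 → ℂ) : Mat2 :=
  (Complex.I / crossDet v w) • !![v 0 * w 1 + w 0 * v 1, -(2 * v 0 * w 0);
    2 * v 1 * w 1, -(v 0 * w 1 + w 0 * v 1)]

/-- The entries and `crossDet` scale by the same factor `a b`, so the matrix depends only on the two
lines. -/
theorem rotMat_smul {a b : ℂ} (ha : a ≠ 0) (hb : b ≠ 0) (v w : Fin 2 → ℂ) :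
    rotMat (a • v) (b • w) = rotMat v w := by
  have h : crossDet (a • v) (b • w) = a * b * crossDet v w := by
    simp only [crossDet, Pi.smul_apply, smul_eq_mul]
    ring
  have h1 : Complex.I / crossDet v w = a * b * (Complex.I / crossDet (a • v) (b • w)) := by
    rw [h, mul_div_assoc', mul_div_mul_left _ _ (mul_ne_zero ha hb)]
  rw [rotMat, rotMat, h1]
  ext i j
  fin_cases i <;> fin_cases j <;> simp <;> ring

theorem det_rotMat {v w : Fin 2 → ℂ} (h : crossDet v w ≠ 0) : (rotMat v w).det = 1 := by
  have hk : Complex.I / crossDet v w * (v 0 * w 1 - v 1 * w 0) = Complex.I := div_mul_cancel₀ _ h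
  rw [rotMat, Matrix.det_fin_two]
  simp
  linear_combination (-(Complex.I / crossDet v w * (v 0 * w 1 - v 1 * w 0)) - Complex.I) * hk -
    Complex.I_mul_I

theorem trace_rotMat (v w : Fin 2 → ℂ) : (rotMat v w).trace = 0 := by
  rw [rotMat, Matrix.trace_fin_two]
  simp
  ring

theorem rotMat_mulVec_left {v w : Fin 2 → ℂ} (h : crossDet v w ≠ 0) :
    (rotMat v w).mulVec v = Complex.I • v := by
  rw [rotMat, Matrix.smul_mulVec]
  ext i
  fin_cases i <;> simp [dotProduct, Fin.sum_univ_two, div_mul_eq_mul_div, div_eq_iff h] <;> rw [crossDet] <;> ring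

theorem rotMat_mulVec_right {v w : Fin 2 → ℂ} (h : crossDet v w ≠ 0) :
    (rotMat v w).mulVec w = -Complex.I • w := by
  rw [rotMat, Matrix.smul_mulVec]
  ext i
  fin_cases i <;> simp [dotProduct, Fin.sum_univ_two, div_mul_eq_mul_div, div_eq_iff h] <;> rw [crossDet] <;> ring

theorem eq_of_mulVec_eq {v w : Fin 2 → ℂ} (h : crossDet v w ≠ 0) {M N : Mat2}
    (hv : M.mulVec v = N.mulVec v) (hw : M.mulVec w = N.mulVec w) : M = N := by
  have hv' := fun i => congrFun hv i
  have hw' := fun i => congrFun hw i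
  simp only [Matrix.mulVec, dotProduct, Fin.sum_univ_two] at hv' hw'
  ext i j
  fin_cases j
  · change M i 0 = N i 0
    apply mul_right_cancel₀ h
    simp only [crossDet]
    linear_combination w 1 * hv' i - v 1 * hw' i
  · change M i 1 = N i 1
    apply mul_right_cancel₀ h
    simp only [crossDet]
    linear_combination v 0 * hw' i - w 0 * hv' i

theorem crossDet_mulVec (A : Mat2) (v w : Fin 2 → ℂ) :
    crossDet (A.mulVec v) (A.mulVec w) = A.det * crossDet v w := by
  simp only [crossDet, Matrix.mulVec, dotProduct, Fin.sum_univ_two, Matrix.det_fin_two]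
  ring

/-- Equivariance: conjugating moves the eigenlines and keeps the eigenvalues, and these data
determine the matrix. -/
theorem rotMat_mulVec (A : SL(2, ℂ)) {v w : Fin 2 → ℂ} (h : crossDet v w ≠ 0) :
    (A⁻¹).1 * rotMat (A.1.mulVec v) (A.1.mulVec w) * A.1 = rotMat v w := by
  have hA : crossDet (A.1.mulVec v) (A.1.mulVec w) ≠ 0 := by rwa [crossDet_mulVec, A.2, one_mul]
  have hinv : ∀ u, (A⁻¹).1.mulVec (A.1.mulVec u) = u := fun u => by
    have h1 : (A⁻¹).1 * A.1 = 1 := congrArg Subtype.val (inv_mul_cancel A)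
    rw [Matrix.mulVec_mulVec, h1, Matrix.one_mulVec]
  apply eq_of_mulVec_eq h
  · rw [← Matrix.mulVec_mulVec, ← Matrix.mulVec_mulVec, rotMat_mulVec_left hA, rotMat_mulVec_left h,
      Matrix.mulVec_smul, hinv]
  · rw [← Matrix.mulVec_mulVec, ← Matrix.mulVec_mulVec, rotMat_mulVec_right hA,
      rotMat_mulVec_right h, Matrix.mulVec_smul, hinv]

theorem crossDet_boundaryVector (γ : GSpace) :
    crossDet (boundaryVector γ.1.1) (boundaryVector γ.1.2) ≠ 0 := fun h => γ.2 (by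
  have h1 := lineOf_eq_of_det_eq_zero (boundaryVector_ne_zero γ.1.1) (boundaryVector_ne_zero γ.1.2)
    (sub_eq_zero.1 h)
  rwa [lineOf_boundaryVector, lineOf_boundaryVector] at h1)

/-- The trace-free matrix of determinant one with eigenvalue `i` at the first endpoint of a geodesic
and eigenvalue `-i` at the second one. -/
def geodesicMatrix (γ : GSpace) : SLsl :=
  ⟨⟨rotMat (boundaryVector γ.1.1) (boundaryVector γ.1.2), det_rotMat (crossDet_boundaryVector γ)⟩,
    trace_rotMat _ _⟩

/-- The matrix `rotMat` in terms of the affine coordinates of the endpoints. -/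
def affineRotMat (z : ℂ × ℂ) : Mat2Space := fun i j => rotMat ![z.1, 1] ![z.2, 1] i j

theorem affineRotMat_apply (z : ℂ × ℂ) : affineRotMat z =
    ![![Complex.I * (z.1 + z.2) / (z.1 - z.2), -2 * Complex.I * (z.1 * z.2) / (z.1 - z.2)],
      ![2 * Complex.I / (z.1 - z.2), -Complex.I * (z.1 + z.2) / (z.1 - z.2)]] := by
  ext i j
  fin_cases i <;> fin_cases j <;> simp [affineRotMat, rotMat, crossDet] <;> ring

theorem affineCoord_sub_ne_zero {A : SL(2, ℂ)} {γ : GSpace} (h1 : moebius A γ.1.1 ≠ OnePoint.infty)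
    (h2 : moebius A γ.1.2 ≠ OnePoint.infty) : affineCoord A γ.1.1 - affineCoord A γ.1.2 ≠ 0 := by
  intro h
  have h3 : crossDet (A.1.mulVec (boundaryVector γ.1.1)) (A.1.mulVec (boundaryVector γ.1.2)) = 0 := by
    rw [mulVec_boundaryVector h1, mulVec_boundaryVector h2, sub_eq_zero.1 h]
    simp only [crossDet, Pi.smul_apply, smul_eq_mul]
    simp
    ring
  rw [crossDet_mulVec, A.2, one_mul] at h3
  exact crossDet_boundaryVector γ h3

/-- After moving by `A`, both lines are spanned by vectors `(z, 1)`; scaling invariance discards the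
factors and equivariance undoes the move by a conjugation. -/
theorem slMat_geodesicMatrix {A : SL(2, ℂ)} {γ : GSpace} (h1 : moebius A γ.1.1 ≠ OnePoint.infty)
    (h2 : moebius A γ.1.2 ≠ OnePoint.infty) : slMat (geodesicMatrix γ).1 =
      mulCLM (A⁻¹).1 A.1 (affineRotMat (affineCoord A γ.1.1, affineCoord A γ.1.2)) := by
  have h3 := rotMat_mulVec A (crossDet_boundaryVector γ)
  rw [mulVec_boundaryVector h1, mulVec_boundaryVector h2, rotMat_smul (moebius_ne_infty_iff.1 h1)
    (moebius_ne_infty_iff.1 h2)] at h3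
  funext i j
  exact (congrFun (congrFun h3 i) j).symm

theorem contDiffAt_affineRotMat {z : ℂ × ℂ} (hz : z.1 - z.2 ≠ 0) :
    ContDiffAt ℂ ω affineRotMat z := by
  rw [funext affineRotMat_apply]
  refine contDiffAt_pi.2 fun i => contDiffAt_pi.2 fun j => ?_
  fin_cases i <;> fin_cases j <;> exact ContDiffAt.div (by fun_prop) (by fun_prop) hz

theorem fderiv_affineRotMat {z : ℂ × ℂ} (hz : z.1 - z.2 ≠ 0) (a : ℂ × ℂ) :
    fderiv ℂ affineRotMat z a = (2 * Complex.I / (z.1 - z.2) ^ 2) •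
      ![![z.1 * a.2 - a.1 * z.2, a.1 * z.2 ^ 2 - a.2 * z.1 ^ 2],
        ![a.2 - a.1, -(z.1 * a.2 - a.1 * z.2)]] := by
  have hl := ((contDiffAt_affineRotMat hz).differentiableAt (by simp)).hasFDerivAt.hasLineDerivAt a
  refine HasLineDerivAt.unique hl ?_
  have e1 : HasDerivAt (fun t : ℂ => (z + t • a).1) a.1 0 := by
    simpa using ((hasDerivAt_id' (0 : ℂ)).mul_const a.1).const_add z.1
  have e2 : HasDerivAt (fun t : ℂ => (z + t • a).2) a.2 0 := by
    simpa using ((hasDerivAt_id' (0 : ℂ)).mul_const a.2).const_add z.2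
  have e3 := e1.fun_sub e2
  have hz' : (z + (0 : ℂ) • a).1 - (z + (0 : ℂ) • a).2 ≠ 0 := by simpa using hz
  rw [HasLineDerivAt]
  simp only [affineRotMat_apply]
  refine hasDerivAt_pi.2 fun i => hasDerivAt_pi.2 fun j => ?_
  fin_cases i <;> fin_cases j
  · refine (((e1.fun_add e2).const_mul Complex.I).fun_div e3 hz').congr_deriv ?_
    simp
    field_simp
    ring
  · refine (((e1.fun_mul e2).const_mul (-2 * Complex.I)).fun_div e3 hz').congr_deriv ?_
    simp
    field_simp
    ring
  · refine ((hasDerivAt_const (0 : ℂ) (2 * Complex.I)).fun_div e3 hz').congr_deriv ?_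
    simp
    field_simp
    ring
  · refine (((e1.fun_add e2).const_mul (-Complex.I)).fun_div e3 hz').congr_deriv ?_
    simp
    field_simp
    ring

/-- The source of the metric of `𝒢`: the prefactor `2i / (z₁ - z₂)²` of the derivative contributes
`-4 / (z₁ - z₂)⁴`, and the remaining matrices pair to `(z₁ - z₂)²` times the symmetric product. -/
theorem detForm_fderiv_affineRotMat {z : ℂ × ℂ} (hz : z.1 - z.2 ≠ 0) (a b : ℂ × ℂ) :
    detForm (fderiv ℂ affineRotMat z a) (fderiv ℂ affineRotMat z b) =
      -4 / (z.1 - z.2) ^ 2 * (1 / 2 * (a.1 * b.2 + a.2 * b.1)) := by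
  rw [fderiv_affineRotMat hz, fderiv_affineRotMat hz, map_smul, LinearMap.map_smul₂, detForm_apply]
  simp
  field_simp
  rw [Complex.I_sq]
  ring

end RotationMatrix

/-! ### The metric of the space of geodesics as a pullback -/

section GeodesicMetric

theorem contMDiffAt_affineCoord_fst {A : SL(2, ℂ)} {γ : GSpace}
    (h : moebius A γ.1.1 ≠ OnePoint.infty) : ContMDiffAt (𝓘(ℂ).prod 𝓘(ℂ)) 𝓘(ℂ) ω
      (fun γ : GSpace => affineCoord A γ.1.1) γ :=
  (contMDiffAt_affineCoord h).comp γ (contMDiff_fst.comp contMDiff_subtype_val).contMDiffAt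

theorem contMDiffAt_affineCoord_snd {A : SL(2, ℂ)} {γ : GSpace}
    (h : moebius A γ.1.2 ≠ OnePoint.infty) : ContMDiffAt (𝓘(ℂ).prod 𝓘(ℂ)) 𝓘(ℂ) ω
      (fun γ : GSpace => affineCoord A γ.1.2) γ :=
  (contMDiffAt_affineCoord h).comp γ (contMDiff_snd.comp contMDiff_subtype_val).contMDiffAt

theorem slMat_geodesicMatrix_eventuallyEq {A : SL(2, ℂ)} {γ : GSpace}
    (h1 : moebius A γ.1.1 ≠ OnePoint.infty) (h2 : moebius A γ.1.2 ≠ OnePoint.infty) :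
    (fun γ : GSpace => slMat (geodesicMatrix γ).1) =ᶠ[𝓝 γ] mulCLM (A⁻¹).1 A.1 ∘ affineRotMat ∘
      fun γ : GSpace => (affineCoord A γ.1.1, affineCoord A γ.1.2) := by
  have c1 : Continuous fun γ : GSpace => γ.1.1 := continuous_fst.comp continuous_subtype_val
  have c2 : Continuous fun γ : GSpace => γ.1.2 := continuous_snd.comp continuous_subtype_val
  filter_upwards [c1.continuousAt.eventually (eventually_moebius_ne_infty h1),
    c2.continuousAt.eventually (eventually_moebius_ne_infty h2)] with γ' h1' h2'
  exact slMat_geodesicMatrix h1' h2'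

theorem contMDiff_geodesicMatrix :
    ContMDiff (𝓘(ℂ).prod 𝓘(ℂ)) 𝓘(ℂ, Fin 2 → ℂ) ω geodesicMatrix := by
  apply slsl_isRegularLevelSet.contMDiff_of_comp
  intro γ
  obtain ⟨A, h1, h2⟩ := exists_affineCoord γ
  refine ContMDiffAt.congr_of_eventuallyEq ?_ (slMat_geodesicMatrix_eventuallyEq h1 h2)
  refine (mulCLM (A⁻¹).1 A.1).contDiff.contMDiff.contMDiffAt.comp γ ?_
  exact (contDiffAt_affineRotMat (affineCoord_sub_ne_zero h1 h2)).contMDiffAt.comp γ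
    ((contMDiffAt_affineCoord_fst h1).prodMk_space (contMDiffAt_affineCoord_snd h2))

theorem mfderiv_slMat_geodesicMatrix {A : SL(2, ℂ)} {γ : GSpace}
    (h1 : moebius A γ.1.1 ≠ OnePoint.infty) (h2 : moebius A γ.1.2 ≠ OnePoint.infty)
    (u : TangentSpace (𝓘(ℂ).prod 𝓘(ℂ)) γ) :
    mfderiv (𝓘(ℂ).prod 𝓘(ℂ)) 𝓘(ℂ, Mat2Space) (fun γ : GSpace => slMat (geodesicMatrix γ).1) γ u =
      mulCLM (A⁻¹).1 A.1 (fderiv ℂ affineRotMat (affineCoord A γ.1.1, affineCoord A γ.1.2)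
        (mfderiv (𝓘(ℂ).prod 𝓘(ℂ)) 𝓘(ℂ) (fun γ : GSpace => affineCoord A γ.1.1) γ u,
          mfderiv (𝓘(ℂ).prod 𝓘(ℂ)) 𝓘(ℂ) (fun γ : GSpace => affineCoord A γ.1.2) γ u)) := by
  have d1 := ((contMDiffAt_affineCoord_fst h1).mdifferentiableAt (by simp)).hasMFDerivAt
  have d2 := ((contMDiffAt_affineCoord_snd h2).mdifferentiableAt (by simp)).hasMFDerivAt
  have d3 : HasMFDerivAt (𝓘(ℂ).prod 𝓘(ℂ)) 𝓘(ℂ, ℂ × ℂ)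
      (fun γ : GSpace => (affineCoord A γ.1.1, affineCoord A γ.1.2)) γ
      ((mfderiv (𝓘(ℂ).prod 𝓘(ℂ)) 𝓘(ℂ) (fun γ : GSpace => affineCoord A γ.1.1) γ).prod
        (mfderiv (𝓘(ℂ).prod 𝓘(ℂ)) 𝓘(ℂ) (fun γ : GSpace => affineCoord A γ.1.2) γ)) :=
    ⟨d1.1.prodMk d2.1, d1.2.prodMk d2.2⟩
  have d4 := ((contDiffAt_affineRotMat (z := (affineCoord A γ.1.1, affineCoord A γ.1.2))
    (affineCoord_sub_ne_zero h1 h2)).differentiableAt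
    (by simp)).hasFDerivAt.hasMFDerivAt
  have d5 := (mulCLM (A⁻¹).1 A.1).hasFDerivAt.hasMFDerivAt.comp γ (d4.comp γ d3)
  exact DFunLike.congr_fun
    (d5.congr_of_eventuallyEq (slMat_geodesicMatrix_eventuallyEq h1 h2)).mfderiv u

/-- The outer conjugation by `A` preserves `detForm`, so only the computation for `affineRotMat`
remains. As `A` occurs on the right only, all admissible affine coordinates give the same form. -/
theorem pullback_geodesicMatrix {A : SL(2, ℂ)} {γ : GSpace}
    (h1 : moebius A γ.1.1 ≠ OnePoint.infty) (h2 : moebius A γ.1.2 ≠ OnePoint.infty) :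
    metricSLsl.pullback geodesicMatrix γ = affineForm A γ := by
  rw [metricSLsl_eq_pullback, ← BilinField.pullback_comp _
    (slsl_isRegularLevelSet.mdifferentiable rfl)
    (contMDiff_geodesicMatrix.mdifferentiable (by simp))]
  ext u v
  refine (congrArg₂ (fun a b => detForm a b) (mfderiv_slMat_geodesicMatrix h1 h2 u)
    (mfderiv_slMat_geodesicMatrix h1 h2 v)).trans ?_
  refine (detForm_mulCLM _ _ _ _).trans ?_
  rw [Matrix.SpecialLinearGroup.det_coe, Matrix.SpecialLinearGroup.det_coe, one_mul, one_mul,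
    detForm_fderiv_affineRotMat (affineCoord_sub_ne_zero h1 h2)]
  rfl

theorem metricG_eq_pullback : metricG = metricSLsl.pullback geodesicMatrix := by
  funext γ
  obtain ⟨h1, h2⟩ := (exists_affineCoord γ).choose_spec
  exact (pullback_geodesicMatrix h1 h2).symm

theorem metricG_eq_affineForm {A : SL(2, ℂ)} {γ : GSpace}
    (h1 : moebius A γ.1.1 ≠ OnePoint.infty) (h2 : moebius A γ.1.2 ≠ OnePoint.infty) :
    metricG γ = affineForm A γ := by
  rw [metricG_eq_pullback, pullback_geodesicMatrix h1 h2]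

end GeodesicMetric

/-! ### Recovering a geodesic from the eigenlines of a matrix -/

section Eigenlines

theorem trace_eq_SLsl (A : SLsl) : A.1.1 0 0 + A.1.1 1 1 = 0 :=
  (Matrix.trace_fin_two _).symm.trans A.2

theorem det_eq_SLsl (A : SLsl) : A.1.1 0 0 * A.1.1 1 1 - A.1.1 0 1 * A.1.1 1 0 = 1 :=
  (Matrix.det_fin_two _).symm.trans A.1.2

theorem mulVec_eq_smul_iff {M : Mat2} {c : ℂ} {v : Fin 2 → ℂ} : M.mulVec v = c • v ↔
    M 0 0 * v 0 + M 0 1 * v 1 = c * v 0 ∧ M 1 0 * v 0 + M 1 1 * v 1 = c * v 1 := by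
  simp [funext_iff, Fin.forall_fin_two]

/-- The `j`-th column of `A + i`, an eigenvector for the eigenvalue `i` if it does not vanish. -/
def eigenCol (j : Fin 2) (A : SLsl) : Fin 2 → ℂ :=
  fun k => slMat A.1 k j + Complex.I * (if k = j then 1 else 0)

/-- By Cayley–Hamilton with trace zero and determinant one, `A² = -1`, hence `(A - i)(A + i) = 0`.
-/
theorem mulVec_eigenCol (j : Fin 2) (A : SLsl) :
    A.1.1.mulVec (eigenCol j A) = Complex.I • eigenCol j A := by
  have h1 := trace_eq_SLsl A
  have h2 := det_eq_SLsl A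
  rw [mulVec_eq_smul_iff]
  fin_cases j <;> simp [eigenCol, slMat]
  · constructor
    · linear_combination A.1.1 0 0 * h1 - h2 - Complex.I_mul_I
    · linear_combination A.1.1 1 0 * h1
  · constructor
    · linear_combination A.1.1 0 1 * h1
    · linear_combination A.1.1 1 1 * h1 - h2 - Complex.I_mul_I

/-- If both columns vanished, so would the trace of `A + i`, which is `2i`. -/
theorem exists_eigenCol_ne_zero (A : SLsl) : ∃ j, eigenCol j A ≠ 0 := by
  by_contra! h
  have h0 := congrFun (h 0) 0
  have h1 := congrFun (h 1) 1
  simp [eigenCol, slMat] at h0 h1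
  have h2 : 2 * Complex.I = 0 := by linear_combination h0 + h1 - trace_eq_SLsl A
  simp at h2

/-- Two independent eigenvectors for `i` would give `A` the trace `2i` instead of zero. Hence the
eigenline does not depend on the column chosen. -/
theorem lineOf_eq_of_eigenvector (A : SLsl) {v w : Fin 2 → ℂ} (hv : v ≠ 0) (hw : w ≠ 0)
    (hAv : A.1.1.mulVec v = Complex.I • v) (hAw : A.1.1.mulVec w = Complex.I • w) :
    lineOf v = lineOf w := by
  obtain ⟨v1, v2⟩ := mulVec_eq_smul_iff.1 hAv
  obtain ⟨w1, w2⟩ := mulVec_eq_smul_iff.1 hAw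
  have h : 2 * Complex.I * (v 0 * w 1 - v 1 * w 0) = 0 := by
    linear_combination (v 0 * w 1 - v 1 * w 0) * trace_eq_SLsl A - w 1 * v1 + v 1 * w1 -
      v 0 * w2 + w 0 * v2
  exact lineOf_eq_of_det_eq_zero hv hw (sub_eq_zero.1 (by simpa using h))

/-- The point of the sphere corresponding to the eigenline for the eigenvalue `i`. -/
def eigenline (A : SLsl) : OnePoint ℂ := lineOf (eigenCol (exists_eigenCol_ne_zero A).choose A)

theorem eigenline_eq {A : SLsl} {v : Fin 2 → ℂ} (hv : v ≠ 0)
    (hAv : A.1.1.mulVec v = Complex.I • v) : eigenline A = lineOf v :=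
  lineOf_eq_of_eigenvector A (exists_eigenCol_ne_zero A).choose_spec hv (mulVec_eigenCol _ A) hAv

theorem contMDiff_eigenline : ContMDiff 𝓘(ℂ, Fin 2 → ℂ) 𝓘(ℂ) ω eigenline := by
  intro A
  obtain ⟨j, hj⟩ := exists_eigenCol_ne_zero A
  have h1 : ContMDiff 𝓘(ℂ, Fin 2 → ℂ) 𝓘(ℂ, Fin 2 → ℂ) ω (eigenCol j) := by
    have h2 : ContDiff ℂ ω (fun (X : Mat2Space) (k : Fin 2) =>
      X k j + Complex.I * (if k = j then 1 else 0)) := by fun_prop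
    exact h2.contMDiff.comp slsl_isRegularLevelSet.contMDiff_val
  refine ((contMDiffAt_lineOf hj).comp A h1.contMDiffAt).congr_of_eventuallyEq ?_
  -- The choice of column in `eigenline` may jump with `B`, but the column `j` that works at `A`
  -- works nearby and yields the same line.
  filter_upwards [h1.continuous.continuousAt.eventually_ne hj] with B hB
  exact eigenline_eq hB (mulVec_eigenCol j B)

theorem mulVec_eigenline (A : SLsl) : A.1.1.mulVec (boundaryVector (eigenline A)) =
    Complex.I • boundaryVector (eigenline A) := by
  obtain ⟨j, hj⟩ := exists_eigenCol_ne_zero A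
  obtain ⟨c, hc, h⟩ := exists_smul_boundaryVector_lineOf hj
  rw [eigenline_eq hj (mulVec_eigenCol j A)]
  have h1 := mulVec_eigenCol j A
  rw [h, Matrix.mulVec_smul, smul_comm] at h1
  exact smul_right_injective _ hc h1

theorem coe_negSLsl (A : SLsl) : (negSLsl A).1.1 = -A.1.1 := rfl

/-- The eigenline of `-A` for `i` is that of `A` for `-i`, so one eigenline map provides both
endpoints. -/
theorem mulVec_eigenline_neg (A : SLsl) : A.1.1.mulVec (boundaryVector (eigenline (negSLsl A))) =
    -Complex.I • boundaryVector (eigenline (negSLsl A)) := by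
  have h := mulVec_eigenline (negSLsl A)
  rw [coe_negSLsl, Matrix.neg_mulVec, neg_eq_iff_eq_neg] at h
  rw [h, neg_smul]

/-- The geodesic whose endpoints are the eigenlines of a matrix of trace zero. -/
def eigenGeodesic (A : SLsl) : GSpace :=
  ⟨(eigenline A, eigenline (negSLsl A)), fun h => by
    have h1 := mulVec_eigenline A
    have h' : eigenline A = eigenline (negSLsl A) := h
    rw [h', mulVec_eigenline_neg, neg_smul, neg_eq_self] at h1
    exact (smul_ne_zero Complex.I_ne_zero (boundaryVector_ne_zero _)) h1⟩

theorem coe_geodesicMatrix (γ : GSpace) :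
    (geodesicMatrix γ).1.1 = rotMat (boundaryVector γ.1.1) (boundaryVector γ.1.2) := rfl

theorem eigenGeodesic_geodesicMatrix (γ : GSpace) : eigenGeodesic (geodesicMatrix γ) = γ := by
  have h := crossDet_boundaryVector γ
  refine Subtype.ext (Prod.ext ?_ ?_)
  · exact (eigenline_eq (boundaryVector_ne_zero γ.1.1) (rotMat_mulVec_left h)).trans
      (lineOf_boundaryVector _)
  · refine (eigenline_eq (boundaryVector_ne_zero γ.1.2) ?_).trans (lineOf_boundaryVector _)
    rw [coe_negSLsl, Matrix.neg_mulVec, coe_geodesicMatrix, rotMat_mulVec_right h, neg_smul, neg_neg]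

theorem geodesicMatrix_eigenGeodesic (A : SLsl) : geodesicMatrix (eigenGeodesic A) = A := by
  have h := crossDet_boundaryVector (eigenGeodesic A)
  refine Subtype.ext (Subtype.ext (eq_of_mulVec_eq h ?_ ?_))
  · exact (rotMat_mulVec_left h).trans (mulVec_eigenline A).symm
  · exact (rotMat_mulVec_right h).trans (mulVec_eigenline_neg A).symm

/-- The biholomorphism between oriented geodesics and trace-free matrices of determinant one. -/
def geodesicDiffeo :
    Diffeomorph (𝓘(ℂ).prod 𝓘(ℂ)) 𝓘(ℂ, Fin 2 → ℂ) GSpace SLsl ω where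
  toFun := geodesicMatrix
  invFun := eigenGeodesic
  left_inv := eigenGeodesic_geodesicMatrix
  right_inv := geodesicMatrix_eigenGeodesic
  contMDiff_toFun := contMDiff_geodesicMatrix
  contMDiff_invFun := by
    intro A
    -- Holomorphy into the open subset `𝒢` is tested in the product of two spheres.
    refine (ChartedSpace.liftPropWithinAt_subtypeVal_comp_iff eigenGeodesic univ A).1 ?_
    exact (contMDiff_eigenline.prodMk (contMDiff_eigenline.comp contMDiff_negSLsl)) A

theorem isHolomorphicRiemannian_metricG : IsHolomorphicRiemannian metricG := by
  refine isHolomorphicRiemannian_metricSLsl.of_pullback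
    geodesicDiffeo.symm.isLocalDiffeomorph geodesicDiffeo.symm.surjective ?_
  rw [metricG_eq_pullback, ← BilinField.pullback_comp _
    (contMDiff_geodesicMatrix.mdifferentiable (by simp))
    (geodesicDiffeo.symm.contMDiff.mdifferentiable (by simp)),
    show geodesicMatrix ∘ geodesicDiffeo.symm = id from funext geodesicMatrix_eigenGeodesic]
  funext p
  ext u v
  rw [BilinField.pullback_apply, mfderiv_id]
  rfl

end Eigenlines

/-! ### Rotations of hyperbolic space by the angle `π` -/

section Rotations

theorem mul_vecMulVec_star_mul_conjTranspose (M : Mat2) (a b : Fin 2 → ℂ) :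
    M * Matrix.vecMulVec a (star b) * M.conjTranspose =
      Matrix.vecMulVec (M.mulVec a) (star (M.mulVec b)) := by
  rw [Matrix.mul_vecMulVec, Matrix.vecMulVec_mul, Matrix.star_mulVec]

theorem vecMulVec_smul_star_smul (a b : ℂ) (v w : Fin 2 → ℂ) :
    Matrix.vecMulVec (a • v) (star (b • w)) = (a * star b) • Matrix.vecMulVec v (star w) := by
  ext i j
  simp [Matrix.vecMulVec_apply]
  ring

/-- With `G` the invertible matrix of columns `v` and `w`, write `X = G Y G*`; the coefficients are
the entries of `Y`. -/
theorem exists_eq_sum_vecMulVec {v w : Fin 2 → ℂ} (h : crossDet v w ≠ 0) (X : Mat2) :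
    ∃ a b c d : ℂ, X = a • Matrix.vecMulVec v (star v) + b • Matrix.vecMulVec v (star w) +
      c • Matrix.vecMulVec w (star v) + d • Matrix.vecMulVec w (star w) := by
  let G : Mat2 := !![v 0, w 0; v 1, w 1]
  have hdet : IsUnit G.det := by
    rw [isUnit_iff_ne_zero, Matrix.det_fin_two_of]
    intro h0
    exact h (by rw [crossDet]; linear_combination h0)
  have hdet' : IsUnit G.conjTranspose.det := by
    rw [Matrix.det_conjTranspose]
    exact hdet.star
  obtain ⟨Y, hY⟩ : ∃ Y : Mat2, X = G * Y * G.conjTranspose := by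
    refine ⟨G⁻¹ * X * G.conjTranspose⁻¹, ?_⟩
    rw [← mul_assoc, ← mul_assoc, Matrix.mul_nonsing_inv _ hdet, one_mul, mul_assoc,
      Matrix.nonsing_inv_mul _ hdet', mul_one]
  refine ⟨Y 0 0, Y 0 1, Y 1 0, Y 1 1, ?_⟩
  rw [hY]
  ext i j
  fin_cases i <;> fin_cases j <;>
    simp [G, Matrix.mul_apply, Fin.sum_univ_two, Matrix.vecMulVec_apply, Matrix.vecMul,
      dotProduct] <;> ring

/-- Among the four products, only `w w*` pairs nontrivially with `v v*`, with value `-|crossDet v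
w|² / 2`, and vice versa; so each orthogonality kills one coefficient. -/
theorem exists_eq_of_orthogonal {v w : Fin 2 → ℂ} (h : crossDet v w ≠ 0) {X : Mat2}
    (hv : matForm X (Matrix.vecMulVec v (star v)) = 0)
    (hw : matForm X (Matrix.vecMulVec w (star w)) = 0) :
    ∃ a b : ℂ, X = a • Matrix.vecMulVec v (star w) + b • Matrix.vecMulVec w (star v) := by
  obtain ⟨a, b, c, d, rfl⟩ := exists_eq_sum_vecMulVec h X
  have h' : crossDet v w * star (crossDet v w) ≠ 0 := mul_ne_zero h (star_ne_zero.2 h)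
  rw [matForm_eq_detForm, detForm_apply] at hv hw
  simp only [Matrix.add_apply, Matrix.smul_apply, Matrix.vecMulVec_apply, Pi.star_apply,
    smul_eq_mul] at hv hw
  have hd : d = 0 := by
    apply (mul_eq_zero_iff_left h').1
    simp only [crossDet, star_sub, star_mul']
    linear_combination -2 * hv
  have ha : a = 0 := by
    apply (mul_eq_zero_iff_left h').1
    simp only [crossDet, star_sub, star_mul']
    linear_combination -2 * hw
  exact ⟨b, c, by rw [ha, hd, zero_smul, zero_smul, zero_add, add_zero]⟩

/-- The matrix `v v*` remembers `v` up to a phase. Thus fixing a null vector `v v*` means having `v`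
as an eigenvector with unimodular eigenvalue. -/
theorem exists_smul_eq_of_vecMulVec_eq {v a : Fin 2 → ℂ} (hv : v ≠ 0)
    (h : Matrix.vecMulVec a (star a) = Matrix.vecMulVec v (star v)) :
    ∃ c : ℂ, c * star c = 1 ∧ a = c • v := by
  have h' : ∀ i j, a i * star (a j) = v i * star (v j) := fun i j => congrFun (congrFun h i) j
  obtain ⟨k, hk⟩ := Function.ne_iff.1 hv
  have hk : v k ≠ 0 := hk
  have hk' : star (v k) ≠ 0 := star_ne_zero.2 hk
  have ha : a k ≠ 0 := fun h0 => by
    have := h' k k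
    rw [h0, zero_mul] at this
    exact mul_ne_zero hk hk' this.symm
  have ha' : star (a k) ≠ 0 := star_ne_zero.2 ha
  refine ⟨star (v k) / star (a k), ?_, ?_⟩
  · rw [star_div₀, star_star, star_star, div_mul_div_comm, div_eq_one_iff_eq (mul_ne_zero ha' ha)]
    linear_combination -h' k k
  · funext i
    rw [Pi.smul_apply, smul_eq_mul, div_mul_eq_mul_div, eq_div_iff ha']
    linear_combination h' i k

/-- The determinant of `s v v* + t w w*` is `s t |crossDet v w|²`, so `h` is the equation of the
hyperboloid; positivity of `s` and `t` selects the right sheet. -/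
theorem mem_geodesicLine {γ : GSpace} {s t : ℝ} (hs : 0 < s) (ht : 0 < t)
    (h : s * t * Complex.normSq (crossDet (boundaryVector γ.1.1) (boundaryVector γ.1.2)) = 1) :
    (s : ℂ) • boundaryMatrix γ.1.1 + (t : ℂ) • boundaryMatrix γ.1.2 ∈ geodesicLine γ := by
  have hv := boundaryVector_ne_zero γ.1.1
  have hw := boundaryVector_ne_zero γ.1.2
  have h' := congrArg (fun r : ℝ => (r : ℂ)) h
  simp only [boundaryMatrix] at *
  refine ⟨⟨?_, ?_, ?_⟩, s, t, rfl⟩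
  · ext i j
    simp [Matrix.vecMulVec_apply]
    ring
  · generalize boundaryVector γ.1.1 = v at *
    generalize boundaryVector γ.1.2 = w at *
    rw [Matrix.det_fin_two]
    push_cast at h'
    rw [← Complex.mul_conj, crossDet] at h'
    simp [Matrix.vecMulVec_apply] at h' ⊢
    linear_combination h'
  · generalize boundaryVector γ.1.1 = v at *
    generalize boundaryVector γ.1.2 = w at *
    have key : ∀ {u : Fin 2 → ℂ}, u ≠ 0 → 0 < Complex.normSq (u 0) + Complex.normSq (u 1) := by
      intro u hu
      obtain ⟨k, hk⟩ := Function.ne_iff.1 hu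
      have hk := Complex.normSq_pos.2 hk
      fin_cases k
      · exact add_pos_of_pos_of_nonneg hk (Complex.normSq_nonneg _)
      · exact add_pos_of_nonneg_of_pos (Complex.normSq_nonneg _) hk
    have htr : (((s : ℂ) • Matrix.vecMulVec v (star v) + (t : ℂ) • Matrix.vecMulVec w (star w) :
        Mat2).trace) = ((s * (Complex.normSq (v 0) + Complex.normSq (v 1)) +
        t * (Complex.normSq (w 0) + Complex.normSq (w 1)) : ℝ) : ℂ) := by
      rw [Matrix.trace_fin_two]
      push_cast
      simp [Matrix.vecMulVec_apply, ← Complex.mul_conj]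
      ring
    rw [htr, Complex.ofReal_re]
    exact add_pos (mul_pos hs (key hv)) (mul_pos ht (key hw))

theorem conj_boundaryMatrix_of_forall_mem {γ : GSpace} {A : Mat2}
    (h : ∀ P ∈ geodesicLine γ, A * P * A.conjTranspose = P) :
    A * boundaryMatrix γ.1.1 * A.conjTranspose = boundaryMatrix γ.1.1 ∧
      A * boundaryMatrix γ.1.2 * A.conjTranspose = boundaryMatrix γ.1.2 := by
  have hD := Complex.normSq_pos.2 (crossDet_boundaryVector γ)
  -- The points with `s = 1` and `s = 2` are independent, so they span the plane of the geodesic,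
  -- and the fixed null vectors follow by elimination.
  have h1 := h _ (mem_geodesicLine (γ := γ) one_pos (inv_pos.2 hD)
    (by rw [one_mul, inv_mul_cancel₀ hD.ne']))
  have h2 := h _ (mem_geodesicLine (γ := γ) two_pos (inv_pos.2 (mul_pos two_pos hD))
    (by field_simp))
  generalize Complex.normSq _ = r at h1 h2 hD
  have hr : (r : ℂ) ≠ 0 := by exact_mod_cast hD.ne'
  generalize boundaryMatrix γ.1.1 = S at h1 h2 ⊢
  generalize boundaryMatrix γ.1.2 = T at h1 h2 ⊢
  simp only [mul_add, add_mul, Matrix.mul_smul, Matrix.smul_mul] at h1 h2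
  generalize A * S * A.conjTranspose = S' at h1 h2 ⊢
  generalize A * T * A.conjTranspose = T' at h1 h2 ⊢
  have h1' : ∀ i j, S' i j + (r : ℂ)⁻¹ * T' i j = S i j + (r : ℂ)⁻¹ * T i j := fun i j => by
    simpa using congrFun (congrFun h1 i) j
  have h2' : ∀ i j, 2 * S' i j + (r : ℂ)⁻¹ * 2⁻¹ * T' i j =
      2 * S i j + (r : ℂ)⁻¹ * 2⁻¹ * T i j := fun i j => by
    simpa using congrFun (congrFun h2 i) j
  have hS : ∀ i j, S' i j = S i j := fun i j => by
    linear_combination (-1 / 3 : ℂ) * h1' i j + (2 / 3 : ℂ) * h2' i j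
  refine ⟨Matrix.ext hS, Matrix.ext fun i j => mul_left_cancel₀ (inv_ne_zero hr) ?_⟩
  linear_combination h1' i j - hS i j

/-- With eigenvalues `i` and `-i`, the factor is `i · star i = 1` on `v v*`, likewise `1` on `w w*`,
and `i · star (-i) = -1` on `v w*`, likewise on `w v*`. -/
theorem isPiRotation_geodesicMatrix (γ : GSpace) :
    IsPiRotation γ (toPSL (geodesicMatrix γ).1) := by
  have h := crossDet_boundaryVector γ
  refine ⟨_, rfl, ?_, ?_⟩
  · rintro P ⟨-, s, t, rfl⟩
    rw [coe_geodesicMatrix, mul_add, add_mul, Matrix.mul_smul, Matrix.smul_mul, Matrix.mul_smul,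
      Matrix.smul_mul, boundaryMatrix, boundaryMatrix, mul_vecMulVec_star_mul_conjTranspose,
      mul_vecMulVec_star_mul_conjTranspose, rotMat_mulVec_left h, rotMat_mulVec_right h,
      vecMulVec_smul_star_smul, vecMulVec_smul_star_smul]
    simp
  · intro X _ h1 h2
    obtain ⟨a, b, rfl⟩ := exists_eq_of_orthogonal h h1 h2
    rw [coe_geodesicMatrix, mul_add, add_mul, Matrix.mul_smul, Matrix.smul_mul, Matrix.mul_smul,
      Matrix.smul_mul, mul_vecMulVec_star_mul_conjTranspose,
      mul_vecMulVec_star_mul_conjTranspose, rotMat_mulVec_left h, rotMat_mulVec_right h,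
      vecMulVec_smul_star_smul, vecMulVec_smul_star_smul]
    simp
    abel

/-- Fixing the geodesic makes `v` and `w` eigenvectors with unimodular eigenvalues `c` and `d`,
where `c d = 1`. Acting by `-1` on a normal vector gives `c · star d = -1`, so `c = -d` and `d² =
-1`. The two solutions differ by a sign, which is invisible in `PSL(2, ℂ)`. -/
theorem eq_of_isPiRotation {γ : GSpace} {R : PSL(2, ℂ)} (hR : IsPiRotation γ R) :
    R = toPSL (geodesicMatrix γ).1 := by
  obtain ⟨A, rfl, hfix, hneg⟩ := hR
  have h := crossDet_boundaryVector γ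
  obtain ⟨h1, h2⟩ := conj_boundaryMatrix_of_forall_mem hfix
  have hleft := rotMat_mulVec_left h
  have hright := rotMat_mulVec_right h
  rw [← coe_geodesicMatrix] at hleft hright
  have hw := boundaryVector_ne_zero γ.1.2
  rw [boundaryMatrix, mul_vecMulVec_star_mul_conjTranspose] at h1 h2
  obtain ⟨c, hc, hcv⟩ := exists_smul_eq_of_vecMulVec_eq (boundaryVector_ne_zero γ.1.1) h1
  obtain ⟨d, hd, hdw⟩ := exists_smul_eq_of_vecMulVec_eq hw h2
  have hcd : c * d = 1 := by
    have h3 := crossDet_mulVec A.1 (boundaryVector γ.1.1) (boundaryVector γ.1.2)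
    rw [hcv, hdw, A.2, one_mul] at h3
    apply mul_right_cancel₀ h
    rw [one_mul]
    refine Eq.trans ?_ h3
    simp only [crossDet, Pi.smul_apply, smul_eq_mul]
    ring
  -- The test vector is `v w* + w v*`, a Hermitian matrix orthogonal to both null vectors.
  have h4 := hneg (Matrix.vecMulVec (boundaryVector γ.1.1) (star (boundaryVector γ.1.2)) +
    Matrix.vecMulVec (boundaryVector γ.1.2) (star (boundaryVector γ.1.1))) ?_ ?_ ?_
  · rw [mul_add, add_mul, mul_vecMulVec_star_mul_conjTranspose,
      mul_vecMulVec_star_mul_conjTranspose, hcv, hdw, vecMulVec_smul_star_smul,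
      vecMulVec_smul_star_smul] at h4
    have h5 : c * star d = -1 := by
      obtain ⟨k, hk⟩ := Function.ne_iff.1 hw
      have hk' : star (boundaryVector γ.1.2 k) ≠ 0 := star_ne_zero.2 hk
      have e0 := congrFun (congrFun h4 0) k
      have e1 := congrFun (congrFun h4 1) k
      simp only [Matrix.add_apply, Matrix.smul_apply, Matrix.neg_apply, Matrix.vecMulVec_apply,
        Pi.star_apply, smul_eq_mul] at e0 e1
      apply mul_right_cancel₀ (mul_ne_zero h hk')
      rw [crossDet]
      -- Taking the cross product of the `k`-th column with `w` removes the `w v*` terms and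
      -- isolates the coefficient of `v w*`.
      linear_combination boundaryVector γ.1.2 1 * e0 - boundaryVector γ.1.2 0 * e1
    have h6 : c = -d := by linear_combination d * h5 - c * hd
    have h7 : (d - Complex.I) * (d + Complex.I) = 0 := by
      rw [h6] at hcd
      linear_combination -hcd - Complex.I_mul_I
    rw [toPSL_eq_iff]
    rcases mul_eq_zero.1 h7 with h8 | h8
    · right
      have hd' : d = Complex.I := sub_eq_zero.1 h8
      refine Subtype.ext (eq_of_mulVec_eq h ?_ ?_)
      · refine hleft.trans ?_
        change _ = (-A.1).mulVec _
        rw [Matrix.neg_mulVec, hcv, h6, hd', neg_smul, neg_neg]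
      · refine hright.trans ?_
        change _ = (-A.1).mulVec _
        rw [Matrix.neg_mulVec, hdw, hd', neg_smul]
    · left
      have hd' : d = -Complex.I := eq_neg_of_add_eq_zero_left h8
      refine Subtype.ext (eq_of_mulVec_eq h ?_ ?_)
      · refine hleft.trans ?_
        rw [hcv, h6, hd', neg_neg]
      · refine hright.trans ?_
        rw [hdw, hd']
  · rw [Matrix.IsHermitian, Matrix.conjTranspose_add, Matrix.conjTranspose_vecMulVec,
      Matrix.conjTranspose_vecMulVec, star_star, star_star, add_comm]
  · rw [boundaryMatrix, matForm_apply]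
    simp [Matrix.trace_fin_two, Matrix.mul_apply, Fin.sum_univ_two, Matrix.vecMulVec_apply]
    ring
  · rw [boundaryMatrix, matForm_apply]
    simp [Matrix.trace_fin_two, Matrix.mul_apply, Fin.sum_univ_two, Matrix.vecMulVec_apply]
    ring

/-- The map sending a geodesic to the rotation of angle `π` around it. -/
def piRotation (γ : GSpace) : QSpace := toQ (geodesicMatrix γ)

theorem isPiRotation_iff (γ : GSpace) (R : PSL(2, ℂ)) :
    IsPiRotation γ R ↔ R = (piRotation γ).1 :=
  ⟨eq_of_isPiRotation, fun h => h ▸ isPiRotation_geodesicMatrix γ⟩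

theorem isLocalIsometry_toQ : IsLocalIsometry metricSLsl metricQ toQ :=
  ⟨isLocalDiffeomorph_toQ, pullback_metricQ⟩

theorem isLocalIsometry_piRotation : IsLocalIsometry metricG metricQ piRotation := by
  refine ⟨fun γ => IsLocalDiffeomorphAt.comp (hf := geodesicDiffeo.isLocalDiffeomorph γ)
    (hg := isLocalDiffeomorph_toQ _), ?_⟩
  rw [metricG_eq_pullback, ← pullback_metricQ]
  exact BilinField.pullback_comp _ (isLocalDiffeomorph_toQ.mdifferentiable (by simp))
    (contMDiff_geodesicMatrix.mdifferentiable (by simp))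

theorem isCoveringMap_piRotation : IsCoveringMap piRotation :=
  toQ_isCoveringMap.comp_homeomorph geodesicDiffeo.toHomeomorph

theorem ncard_preimage_piRotation (R : QSpace) : (piRotation ⁻¹' {R}).ncard = 2 := by
  have h : range geodesicMatrix = univ := geodesicDiffeo.surjective.range_eq
  exact (ncard_preimage_of_injective_subset_range (f := geodesicMatrix) (s := toQ ⁻¹' {R})
    geodesicDiffeo.injective (h ▸ subset_univ _)).trans (ncard_preimage_toQ R)

/-- The isometry from `𝕏₂` to the space of oriented geodesics. -/
def quadricGeodesicDiffeo :
    Diffeomorph 𝓘(ℂ, Fin 2 → ℂ) (𝓘(ℂ).prod 𝓘(ℂ)) (Quadric 2) GSpace ω :=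
  quadricTwoDiffeo.trans geodesicDiffeo.symm

theorem geodesicMatrix_quadricGeodesicDiffeo (z : Quadric 2) :
    geodesicMatrix (quadricGeodesicDiffeo z) = quadricTwoDiffeo z :=
  geodesicMatrix_eigenGeodesic _

theorem isIsometry_quadricGeodesicDiffeo :
    IsIsometry (quadricMetric 2) metricG quadricGeodesicDiffeo := by
  rw [IsIsometry, metricG_eq_pullback, ← BilinField.pullback_comp _
    (contMDiff_geodesicMatrix.mdifferentiable (by simp))
    (quadricGeodesicDiffeo.contMDiff.mdifferentiable (by simp)),
    show geodesicMatrix ∘ quadricGeodesicDiffeo = quadricTwoDiffeo from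
      funext geodesicMatrix_quadricGeodesicDiffeo]
  exact isIsometry_quadricTwoDiffeo

theorem piRotation_quadricGeodesicDiffeo (z : Quadric 2) {A : SL(2, ℂ)}
    (hA : (A : Mat2) = mapF ![z.1 0, z.1 1, z.1 2, 0]) :
    (piRotation (quadricGeodesicDiffeo z)).1 = toPSL A := by
  rw [piRotation, geodesicMatrix_quadricGeodesicDiffeo]
  exact congrArg toPSL (Subtype.ext hA.symm)

end Rotations

end

theorem mainTheorem3 :
    -- all the metrics involved are holomorphic Riemannian metrics
    (IsHolomorphicRiemannian (quadricMetric 3) ∧ IsHolomorphicRiemannian (quadricMetric 2) ∧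
      IsHolomorphicRiemannian metricSL ∧ IsHolomorphicRiemannian metricPSL ∧
      IsHolomorphicRiemannian metricSLsl ∧ IsHolomorphicRiemannian metricQ ∧
      IsHolomorphicRiemannian metricG) ∧
    -- the metric of `𝒢` is given by the same formula in every affine coordinate
    (∀ (A : SL(2, ℂ)) (γ : GSpace), moebius A γ.1.1 ≠ OnePoint.infty →
      moebius A γ.1.2 ≠ OnePoint.infty → metricG γ = affineForm A γ) ∧
    -- `F` is a linear isometry from `ℂ⁴` to `Mat(2, ℂ)` with the quadratic form `-det`
    (∀ M : Mat2, matForm M M = -M.det) ∧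
    Function.Bijective mapF ∧
    (∀ z w : Fin 4 → ℂ, matForm (mapF z) (mapF w) = stdForm 4 z w) ∧
    -- `F` restricts to an isometry from `𝕏₃` onto `SL(2, ℂ)`
    (∃ Φ : Diffeomorph 𝓘(ℂ, Fin 3 → ℂ) 𝓘(ℂ, Fin 3 → ℂ) (Quadric 3) SL(2, ℂ) ω,
      IsIsometry (quadricMetric 3) metricSL Φ ∧ ∀ z : Quadric 3, (Φ z : Mat2) = mapF z.1) ∧
    -- `F` maps `𝕏₂` isometrically onto `SL(2, ℂ) ∩ 𝔰𝔩₂`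
    mapF '' {z | z 3 = 0 ∧ ∑ i, z i ^ 2 = -1} = {M | M.det = 1 ∧ M.trace = 0} ∧
    (∃ Ψ : Diffeomorph 𝓘(ℂ, Fin 2 → ℂ) 𝓘(ℂ, Fin 2 → ℂ) (Quadric 2) SLsl ω,
      IsIsometry (quadricMetric 2) metricSLsl Ψ ∧
      ∀ z : Quadric 2, ((Ψ z).1 : Mat2) = mapF ![z.1 0, z.1 1, z.1 2, 0]) ∧
    -- the inclusion of `Q` in `PSL(2, ℂ)` is holomorphic
    ContMDiff 𝓘(ℂ, Fin 2 → ℂ) 𝓘(ℂ, Fin 3 → ℂ) ω (Subtype.val : QSpace → PSL(2, ℂ)) ∧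
    -- the projection `SL(2, ℂ) ∩ 𝔰𝔩₂ → Q` is an isometric double covering
    (IsLocalIsometry metricSLsl metricQ toQ ∧ IsCoveringMap toQ ∧
      ∀ R : QSpace, (toQ ⁻¹' {R}).ncard = 2) ∧
    -- so is the rotation map, and it lifts to an isometry
    ∃ Rot : GSpace → QSpace,
      (∀ (γ : GSpace) (R : PSL(2, ℂ)), IsPiRotation γ R ↔ R = (Rot γ).1) ∧
      IsLocalIsometry metricG metricQ Rot ∧ IsCoveringMap Rot ∧
      (∀ R : QSpace, (Rot ⁻¹' {R}).ncard = 2) ∧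
      ∃ Θ : Diffeomorph 𝓘(ℂ, Fin 2 → ℂ) (𝓘(ℂ).prod 𝓘(ℂ)) (Quadric 2) GSpace ω,
        IsIsometry (quadricMetric 2) metricG Θ ∧
        ∀ (z : Quadric 2) (A : SL(2, ℂ)), (A : Mat2) = mapF ![z.1 0, z.1 1, z.1 2, 0] →
          (Rot (Θ z)).1 = toPSL A := by
  exact ⟨⟨isHolomorphicRiemannian_quadricMetric 3, isHolomorphicRiemannian_quadricMetric 2,
      isHolomorphicRiemannian_metricSL, isHolomorphicRiemannian_metricPSL,
      isHolomorphicRiemannian_metricSLsl, isHolomorphicRiemannian_metricQ,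
      isHolomorphicRiemannian_metricG⟩,
    fun _ _ h1 h2 => metricG_eq_affineForm h1 h2, matForm_self, bijective_mapF, matForm_mapF,
    ⟨quadricThreeDiffeo, isIsometry_quadricThreeDiffeo, fun _ => rfl⟩, image_mapF,
    ⟨quadricTwoDiffeo, isIsometry_quadricTwoDiffeo, fun _ => rfl⟩, contMDiff_Q_val,
    ⟨isLocalIsometry_toQ, toQ_isCoveringMap, ncard_preimage_toQ⟩,
    piRotation, isPiRotation_iff, isLocalIsometry_piRotation, isCoveringMap_piRotation,
    ncard_preimage_piRotation, quadricGeodesicDiffeo, isIsometry_quadricGeodesicDiffeo,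
    fun z _ hA => piRotation_quadricGeodesicDiffeo z hA⟩
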